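/- Let $K\subset\mathbb{C}$ be an imaginary quadratic field with ring of integers $\mathcal{O}$ and discriminant $\Delta$, and let $\widehat K=K\cup\{\infty\}\subset\widehat{\mathbb C}=\mathbb{C}\cup\{\infty\}$. An *oriented circle* $C$ is given by a vector $\mathbf v_C=[\zeta,\overline\zeta,\hat r,r]$ with $\zeta\in\mathbb{C}$, $r,\hat r\in\mathbb{R}$ and $|\zeta|^2-\hat r r=1$; its points are the $\alpha/\beta\in\widehat{\mathbb C}$ with $r|\alpha|^2-2\Re(\overline\alpha\beta\zeta)+\hat r|\beta|^2=0$, and $r$ is its *curvature*. For real $D>0$, let $\mathcal{S}_D$ be the set of oriented circles $C$ with $i\sqrt D\,\mathbf v_C\in\mathcal{O}^2\times(\sqrt\Delta\,\mathbb{Z})^2$. A set $\mathcal{A}$ of oriented circles is *finitely connected* if there is $n\in\mathbb{N}$ such that for every $C\in\mathcal{A}$ of nonzero curvature $r$ there are $C=C_0,C_1,\dots,C_n\in\mathcal{A}$ with $C_{k-1}\cap C_k\neq\emptyset$ for $1\le k\le n$ and with the curvature of $C_n$ at most $|r|/2$ in absolute value. It is *rationally connected* if for all $C,C'\in\mathcal{A}$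 there are $n\in\mathbb{N}$ and $C=C_0,C_1,\dots,C_n=C'$ in $\mathcal{A}$ with $C_{k-1}\cap C_k\cap\widehat K\neq\emptyset$ for $1\le k\le n$. Let $D>0$ be a real number such that $\mathcal{S}_D$ is nonempty, finitely connected and rationally connected. Then $D$ is an integer, and the class group of $K$ is generated by the classes of the nonzero prime ideals of $\mathcal{O}$ whose norm divides $D$. -/

import Mathlib

open scoped nonZeroDivisors NumberField ComplexConjugate

noncomputable section

/-- An oriented circle in the extended complex plane, recorded by the vector
`v_C = [ζ, conj ζ, cocurvature, curvature]` with `|ζ|² - cocurvature * curvature = 1`.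
The vectors `v` and `-v` give the two orientations of one circle. -/
structure OrientedCircle where
  /-- the curvature-center `ζ` -/
  center : ℂ
  cocurvature : ℝ
  curvature : ℝ
  norm_sq_eq : ‖center‖ ^ 2 - cocurvature * curvature = 1

namespace OrientedCircle

/-- The points of the circle in `ℂ ∪ {∞}`: the `α/β` with
`r |α|² - 2 Re (conj α * β * ζ) + r' |β|² = 0`, where `r`, `r'`, `ζ` are the curvature, the
cocurvature and the curvature-center.  A finite point is `z/1` and the point at infinity is `1/0`,
for which the equation reads `r = 0`. -/
def points (C : OrientedCircle) : Set (OnePoint ℂ) :=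
  ((↑) : ℂ → OnePoint ℂ) ''
      {z : ℂ | C.curvature * ‖z‖ ^ 2 - 2 * (conj z * C.center).re + C.cocurvature = 0}
    ∪ {p | p = OnePoint.infty ∧ C.curvature = 0}

end OrientedCircle

/-- The arrangement `S_D` of the imaginary quadratic field `K`, embedded in `ℂ` by `σ`, for real
`D > 0`: all oriented circles with `i√D v_C ∈ 𝓞² × (√Δ ℤ)²`, where `√Δ = i√|Δ|`. -/
def circleArrangement {K : Type*} [Field K] [NumberField K] (σ : K →+* ℂ) (D : ℝ) :
    Set OrientedCircle :=
  {C | (∃ a : 𝓞 K, Complex.I * (√D : ℝ) * C.center = σ (a : K)) ∧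
    (∃ b : 𝓞 K, Complex.I * (√D : ℝ) * conj C.center = σ (b : K)) ∧
    (∃ m : ℤ, Complex.I * (√D : ℝ) * C.cocurvature =
      Complex.I * (√(|(NumberField.discr K : ℝ)|) : ℝ) * m) ∧
    (∃ m : ℤ, Complex.I * (√D : ℝ) * C.curvature =
      Complex.I * (√(|(NumberField.discr K : ℝ)|) : ℝ) * m)}

/-- The points of `K ∪ {∞}` inside `ℂ ∪ {∞}`. -/
def extendedField {K : Type*} [Field K] (σ : K →+* ℂ) : Set (OnePoint ℂ) :=
  insert OnePoint.infty (Set.range fun x : K => ((σ x : ℂ) : OnePoint ℂ))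

/-- Any two circles are joined by a chain in which consecutive circles meet in `K ∪ {∞}`. -/
def RationallyConnected {K : Type*} [Field K] (σ : K →+* ℂ) (A : Set OrientedCircle) : Prop :=
  ∀ C ∈ A, ∀ C' ∈ A, ∃ (n : ℕ) (c : ℕ → OrientedCircle),
    c 0 = C ∧ c n = C' ∧ (∀ k ≤ n, c k ∈ A) ∧
    ∀ k < n, ((c k).points ∩ (c (k + 1)).points ∩ extendedField σ).Nonempty

/-- There is one `n` such that every circle of nonzero curvature `r` is joined, by a chain
`C₀, …, Cₙ` of consecutively meeting circles, to one of curvature at most `|r|/2` in magnitude. -/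
def FinitelyConnected (A : Set OrientedCircle) : Prop :=
  ∃ n : ℕ, ∀ C ∈ A, C.curvature ≠ 0 → ∃ c : ℕ → OrientedCircle,
    c 0 = C ∧ (∀ k ≤ n, c k ∈ A) ∧
    (∀ k < n, ((c k).points ∩ (c (k + 1)).points).Nonempty) ∧
    |(c n).curvature| ≤ |C.curvature| / 2

end

/-! Multiplication by i√D turns the circles of `S_D` into skew-Hermitian binary forms H over 𝓞 of
determinant D, and α/β lies on a circle exactly when (α, β) is isotropic for its form. The
determinant is an element of 𝓞 fixed by conjugation, so D is an integer. A vector (α, β) carries the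
class of the ideal it generates (`vectorClass`), and two facts about these classes give the theorem.

Arithmetic (`exists_contentIdeal_relation`): isotropic vectors of one form have classes that differ
by primes of norm dividing D. Let u be isotropic with content I, so that I times its conjugate J is
(g) for an integer g. Choose w with entries in J and det(u, w) = g. In terms of u and w the form has
entries 0, k and gδn, where k has norm g²D and kJ = gBI with N(B) = D. Solving for a second
isotropic vector shows that its content is I·G up to principal factors, where G = (y - qnω) + qB
with y, q coprime integers and ω the element `gen`. A prime containing G must contain B, so its norm
divides D.

Analysis (`FinitelyConnected.exists_isotropic`): every point z of K lies on a circle of the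
arrangement. Otherwise the parabolic maps fixing z give circles of unbounded curvature whose
equations have the same value at z. Descending from these by finite connectedness produces circles
whose equations are arbitrarily small at z (`FinitelyConnected.exists_abs_equation_lt`). This is
absurd, because H(u, u) lies in δℤ and so its nonzero values are bounded away from 0.

Every ideal class comes from a point of K. A rational chain from a circle through 0, whose class is
trivial, to a circle through that point changes the class only by the allowed primes. -/

/-- The conjugation of a quadratic order: an involution whose fixed elements are the integers,
with an element `gen` such that `gen - bar gen = sqrtDiscr` divides all the `z - bar z`. -/
structure QuadraticConjugation (R : Type*) [CommRing R] where
  bar : R ≃+* R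
  bar_bar : ∀ z, bar (bar z) = z
  exists_int_of_bar_eq : ∀ z, bar z = z → ∃ n : ℤ, z = n
  sqrtDiscr : R
  sqrtDiscr_ne_zero : sqrtDiscr ≠ 0
  gen : R
  gen_sub_bar : gen - bar gen = sqrtDiscr
  exists_sub_bar : ∀ z, ∃ n : ℤ, z - bar z = n * sqrtDiscr

/-! ### Skew-Hermitian forms and content ideals over a quadratic order. -/

namespace QuadraticConjugation

variable {R : Type*} [CommRing R] (Q : QuadraticConjugation R)

theorem bar_sqrtDiscr : Q.bar Q.sqrtDiscr = -Q.sqrtDiscr := by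
  rw [← Q.gen_sub_bar, map_sub, Q.bar_bar]; ring

/-- The skew-Hermitian form with diagonal entries `m δ`, `m' δ` and off-diagonal entries
`bar a`, `-a`. -/
def skewForm (a : R) (m m' : ℤ) (u v : R × R) : R :=
  Q.sqrtDiscr * m * u.1 * Q.bar v.1 + Q.bar a * u.1 * Q.bar v.2 - a * u.2 * Q.bar v.1
    + Q.sqrtDiscr * m' * u.2 * Q.bar v.2

/-- The determinant of two vectors. -/
def cross (u v : R × R) : R := u.1 * v.2 - u.2 * v.1

theorem bar_skewForm (a : R) (m m' : ℤ) (u v : R × R) :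
    Q.bar (Q.skewForm a m m' u v) = -Q.skewForm a m m' v u := by
  simp only [skewForm, map_add, map_sub, map_mul, Q.bar_bar, bar_sqrtDiscr, map_intCast]
  ring

/-- The Gram determinant of two vectors is the determinant of the form times the norm of the change
of basis. -/
theorem skewForm_gram (a : R) (m m' : ℤ) (u v : R × R) :
    Q.skewForm a m m' u u * Q.skewForm a m m' v v - Q.skewForm a m m' u v * Q.skewForm a m m' v u =
      (a * Q.bar a + Q.sqrtDiscr ^ 2 * m * m') * (cross u v * Q.bar (cross u v)) := by
  simp only [skewForm, cross, map_sub, map_mul]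
  ring

theorem exists_norm_eq_int (z : R) : ∃ n : ℤ, z * Q.bar z = n :=
  Q.exists_int_of_bar_eq _ (by rw [map_mul, Q.bar_bar, mul_comm])

theorem exists_trace_eq_int (z : R) : ∃ n : ℤ, z + Q.bar z = n :=
  Q.exists_int_of_bar_eq _ (by rw [map_add, Q.bar_bar, add_comm])

theorem exists_skewForm_self (a : R) (m m' : ℤ) (u : R × R) :
    ∃ n : ℤ, Q.skewForm a m m' u u = Q.sqrtDiscr * n := by
  obtain ⟨n₁, h₁⟩ := Q.exists_norm_eq_int u.1
  obtain ⟨n₂, h₂⟩ := Q.exists_norm_eq_int u.2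
  obtain ⟨n₃, h₃⟩ := Q.exists_sub_bar (Q.bar a * u.1 * Q.bar u.2)
  refine ⟨m * n₁ + n₃ + m' * n₂, ?_⟩
  push_cast
  rw [← h₁, ← h₂]
  simp only [map_mul, Q.bar_bar] at h₃
  simp only [skewForm]
  linear_combination h₃

/-- The ideal generated by the coordinates of a vector. -/
def contentIdeal (u : R × R) : Ideal R := Ideal.span {u.1, u.2}

theorem mem_contentIdeal {u : R × R} {x : R} :
    x ∈ contentIdeal u ↔ ∃ a b, a * u.1 + b * u.2 = x := Ideal.mem_span_pair

/-- The coordinatewise conjugate of a vector. -/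
def barVec (u : R × R) : R × R := (Q.bar u.1, Q.bar u.2)

theorem contentIdeal_barVec (u : R × R) :
    contentIdeal (Q.barVec u) = (contentIdeal u).map Q.bar := by
  simp [contentIdeal, barVec, Ideal.map_span, Set.image_pair]

theorem bar_mem_contentIdeal {u : R × R} {x : R} (hx : x ∈ contentIdeal (Q.barVec u)) :
    Q.bar x ∈ contentIdeal u := by
  obtain ⟨a, b, rfl⟩ := mem_contentIdeal.1 hx
  exact mem_contentIdeal.2 ⟨Q.bar a, Q.bar b, by simp [barVec, Q.bar_bar]⟩

/-- The quotient z/g is a root of the monic polynomial X² - bX + c, so it lies in the integrally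
closed ring. -/
theorem dvd_of_sq_eq [IsDomain R] [IsIntegrallyClosed R] {z g b c : R}
    (h : z ^ 2 - g * b * z + g ^ 2 * c = 0) : g ∣ z := by
  by_cases hg : g = 0
  · subst hg
    have : z = 0 := by simpa using h
    simp [this]
  set F := FractionRing R
  have hg' : algebraMap R F g ≠ 0 := by simpa using hg
  have hint : IsIntegral R (algebraMap R F z / algebraMap R F g) := by
    refine ⟨Polynomial.X ^ 2 - Polynomial.C b * Polynomial.X + Polynomial.C c, ?_, ?_⟩
    · monicity!
    · simp only [Polynomial.eval₂_add, Polynomial.eval₂_sub, Polynomial.eval₂_mul,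
        Polynomial.eval₂_pow, Polynomial.eval₂_X, Polynomial.eval₂_C]
      have := congrArg (algebraMap R F) h
      simp only [map_add, map_sub, map_mul, map_pow, map_zero] at this
      have hdiv : algebraMap R F z = algebraMap R F z / algebraMap R F g * algebraMap R F g :=
        (div_mul_cancel₀ _ hg').symm
      refine mul_left_cancel₀ (pow_ne_zero 2 hg') ?_
      generalize algebraMap R F z / algebraMap R F g = x at hdiv
      rw [hdiv] at this
      linear_combination this
  obtain ⟨y, hy⟩ := IsIntegrallyClosed.isIntegral_iff.1 hint
  refine ⟨y, FaithfulSMul.algebraMap_injective R F ?_⟩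
  rw [map_mul, hy, mul_div_cancel₀ _ hg']

/-- The product of the content ideal and its conjugate is generated by an integer. -/
theorem exists_contentIdeal_mul_bar [IsDomain R] [IsIntegrallyClosed R] [CharZero R]
    {u : R × R} (hu : u ≠ 0) :
    ∃ g : ℤ, g ≠ 0 ∧ contentIdeal u * contentIdeal (Q.barVec u) = Ideal.span {(g : R)} := by
  obtain ⟨A, hA⟩ := Q.exists_norm_eq_int u.1
  obtain ⟨C, hC⟩ := Q.exists_norm_eq_int u.2
  obtain ⟨B, hB⟩ := Q.exists_trace_eq_int (u.1 * Q.bar u.2)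
  rw [map_mul, Q.bar_bar] at hB
  have hAC : A ≠ 0 ∨ C ≠ 0 := by
    by_contra! h
    obtain ⟨rfl, rfl⟩ := h
    refine hu (Prod.ext ?_ ?_)
    · simpa using hA
    · simpa using hC
  set g : ℤ := gcd (gcd A C) B with hg
  have hg0 : g ≠ 0 := by
    intro h
    have h' := (gcd_eq_zero_iff _ _).1 h
    have h'' := (gcd_eq_zero_iff _ _).1 h'.1
    tauto
  obtain ⟨A', hA'⟩ : g ∣ A := (gcd_dvd_left _ _).trans (gcd_dvd_left _ _)
  obtain ⟨C', hC'⟩ : g ∣ C := (gcd_dvd_left _ _).trans (gcd_dvd_right _ _)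
  obtain ⟨B', hB'⟩ : g ∣ B := gcd_dvd_right _ _
  -- The mixed product is a root of X² - BX + AC, where g divides B and g² divides AC.
  have hz : (g : R) ∣ u.1 * Q.bar u.2 := by
    refine dvd_of_sq_eq (b := (B' : R)) (c := (A' * C' : R)) ?_
    rw [hA'] at hA
    rw [hB'] at hB
    rw [hC'] at hC
    push_cast at hA hB hC
    linear_combination u.1 * Q.bar u.2 * hB - u.2 * Q.bar u.2 * hA - (g * A' : R) * hC
  have hz' : (g : R) ∣ u.2 * Q.bar u.1 := by
    have := map_dvd Q.bar hz
    rwa [map_mul, Q.bar_bar, map_intCast, mul_comm] at this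
  refine ⟨g, hg0, le_antisymm ?_ ?_⟩
  · simp only [contentIdeal, barVec, Ideal.span_pair_mul_span_pair, Ideal.span_le]
    rintro x (rfl | rfl | rfl | rfl)
    · exact Ideal.mem_span_singleton.2 (by rw [hA, hA']; push_cast; exact dvd_mul_right _ _)
    · exact Ideal.mem_span_singleton.2 hz
    · exact Ideal.mem_span_singleton.2 hz'
    · exact Ideal.mem_span_singleton.2 (by rw [hC, hC']; push_cast; exact dvd_mul_right _ _)
  · rw [Ideal.span_singleton_le_iff_mem]
    have mem (x y : R) (hx : x ∈ contentIdeal u) (hy : y ∈ contentIdeal (Q.barVec u)) :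
        x * y ∈ contentIdeal u * contentIdeal (Q.barVec u) := Ideal.mul_mem_mul hx hy
    have h1 : u.1 ∈ contentIdeal u := Ideal.subset_span (by simp)
    have h2 : u.2 ∈ contentIdeal u := Ideal.subset_span (by simp)
    have h3 : Q.bar u.1 ∈ contentIdeal (Q.barVec u) := Ideal.subset_span (by simp [barVec])
    have h4 : Q.bar u.2 ∈ contentIdeal (Q.barVec u) := Ideal.subset_span (by simp [barVec])
    obtain ⟨x, y, hxy⟩ := exists_gcd_eq_mul_add_mul (gcd A C) B
    obtain ⟨x', y', hxy'⟩ := exists_gcd_eq_mul_add_mul A C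
    have : (g : R) = u.1 * Q.bar u.1 * (x' * x) + u.2 * Q.bar u.2 * (y' * x)
        + (u.1 * Q.bar u.2 + u.2 * Q.bar u.1) * y := by
      rw [hA, hC, mul_comm u.2, hB, hg, hxy, hxy']
      push_cast
      ring
    rw [this]
    refine add_mem (add_mem ?_ ?_) ?_
    · exact Ideal.mul_mem_right _ _ (mem _ _ h1 h3)
    · exact Ideal.mul_mem_right _ _ (mem _ _ h2 h4)
    · exact Ideal.mul_mem_right _ _ (add_mem (mem _ _ h1 h4) (mem _ _ h2 h3))

theorem absNorm_map_bar [IsDedekindDomain R] [Module.Free ℤ R] [Module.Finite ℤ R]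
    (I : Ideal R) : Ideal.absNorm (I.map Q.bar) = Ideal.absNorm I := by
  rw [Ideal.absNorm_apply, Ideal.absNorm_apply, Submodule.cardQuot_apply, Submodule.cardQuot_apply]
  exact (Nat.card_congr (Ideal.quotientEquiv I _ Q.bar rfl).toEquiv).symm

theorem skewForm_smul_add (a : R) (m m' : ℤ) (u v : R × R) (s t : R) :
    Q.skewForm a m m' (s • u + t • v) (s • u + t • v) =
      s * Q.bar s * Q.skewForm a m m' u u + s * Q.bar t * Q.skewForm a m m' u v
        - Q.bar (s * Q.bar t * Q.skewForm a m m' u v)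
        + t * Q.bar t * Q.skewForm a m m' v v := by
  simp only [map_mul, Q.bar_skewForm, Q.bar_bar]
  simp only [skewForm, Prod.fst_add, Prod.snd_add, Prod.smul_fst, Prod.smul_snd, smul_eq_mul,
    map_add, map_mul]
  ring

theorem skewForm_smul_smul (a : R) (m m' : ℤ) (u v : R × R) (s t : R) :
    Q.skewForm a m m' (s • u) (t • v) = s * Q.bar t * Q.skewForm a m m' u v := by
  simp only [skewForm, Prod.smul_fst, Prod.smul_snd, smul_eq_mul, map_mul]
  ring

theorem fst_mem_contentIdeal (u : R × R) : u.1 ∈ contentIdeal u := Ideal.subset_span (by simp)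

theorem snd_mem_contentIdeal (u : R × R) : u.2 ∈ contentIdeal u := Ideal.subset_span (by simp)

theorem cross_mem_mul {I J : Ideal R} {u v : R × R} (hu₁ : u.1 ∈ I) (hu₂ : u.2 ∈ I)
    (hv₁ : v.1 ∈ J) (hv₂ : v.2 ∈ J) : cross u v ∈ I * J :=
  sub_mem (Ideal.mul_mem_mul hu₁ hv₂) (Ideal.mul_mem_mul hu₂ hv₁)

/-- Supplies the complement of u: when J is the conjugate content and g its product with the
content, u and w behave like a basis of determinant g. -/
theorem exists_cross_eq {u : R × R} {J : Ideal R} {g : R} (h : g ∈ contentIdeal u * J) :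
    ∃ w : R × R, w.1 ∈ J ∧ w.2 ∈ J ∧ cross u w = g := by
  rw [contentIdeal, Ideal.span_insert, Ideal.sup_mul, Submodule.mem_sup] at h
  obtain ⟨x, hx, y, hy, rfl⟩ := h
  obtain ⟨p, hp, rfl⟩ := Ideal.mem_span_singleton_mul.1 hx
  obtain ⟨q, hq, rfl⟩ := Ideal.mem_span_singleton_mul.1 hy
  exact ⟨(-q, p), neg_mem hq, hp, by simp [cross]⟩

/-- Cramer's rule: it gives the coordinates of v with respect to u and w without division. -/
theorem smul_eq_cross_smul_add (u v w : R × R) :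
    cross u w • v = cross v w • u + cross u v • w := by
  ext <;> simp [cross] <;> ring

theorem contentIdeal_smul (c : R) (u : R × R) :
    contentIdeal (c • u) = Ideal.span {c} * contentIdeal u := by
  rw [contentIdeal, contentIdeal, Ideal.span_mul_span']
  congr 1
  ext x
  simp [eq_comm]

/-- If `w` is a complement of `u`, the content ideal of `v` is computed from the coordinates of
`v` with respect to `u` and `w`. -/
theorem span_cross_mul_contentIdeal {u v w : R × R} {J : Ideal R} {g : R}
    (hJ : contentIdeal u * J = Ideal.span {g}) (hw₁ : w.1 ∈ J) (hw₂ : w.2 ∈ J)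
    (hg : cross u w = g) :
    Ideal.span {g} * contentIdeal v =
      Ideal.span {cross v w} * contentIdeal u ⊔ Ideal.span {cross u v} * J := by
  apply le_antisymm
  · rw [← contentIdeal_smul, contentIdeal, Ideal.span_le, ← hg, smul_eq_cross_smul_add]
    rintro x (rfl | rfl)
    · exact Submodule.add_mem_sup
        (Ideal.mul_mem_mul (Ideal.mem_span_singleton_self _) (fst_mem_contentIdeal u))
        (Ideal.mul_mem_mul (Ideal.mem_span_singleton_self _) hw₁)
    · exact Submodule.add_mem_sup
        (Ideal.mul_mem_mul (Ideal.mem_span_singleton_self _) (snd_mem_contentIdeal u))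
        (Ideal.mul_mem_mul (Ideal.mem_span_singleton_self _) hw₂)
  · rw [← hJ]
    refine sup_le ?_ ?_
    · have h : Ideal.span {cross v w} ≤ contentIdeal v * J :=
        (Ideal.span_singleton_le_iff_mem _).2
          (cross_mem_mul (fst_mem_contentIdeal v) (snd_mem_contentIdeal v) hw₁ hw₂)
      calc _ ≤ contentIdeal v * J * contentIdeal u := Ideal.mul_mono_left h
        _ = _ := by ring
    · have h : Ideal.span {cross u v} ≤ contentIdeal u * contentIdeal v :=
        (Ideal.span_singleton_le_iff_mem _).2
          (cross_mem_mul (fst_mem_contentIdeal u) (snd_mem_contentIdeal u)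
            (fst_mem_contentIdeal v) (snd_mem_contentIdeal v))
      calc _ ≤ contentIdeal u * contentIdeal v * J := Ideal.mul_mono_left h
        _ = _ := by ring

theorem skewForm_mem (a : R) (m m' : ℤ) {I J : Ideal R} {u v : R × R} (hu₁ : u.1 ∈ I)
    (hu₂ : u.2 ∈ I) (hv₁ : Q.bar v.1 ∈ J) (hv₂ : Q.bar v.2 ∈ J) :
    Q.skewForm a m m' u v ∈ I * J := by
  have e : Q.skewForm a m m' u v = Q.sqrtDiscr * m * (u.1 * Q.bar v.1)
      + Q.bar a * (u.1 * Q.bar v.2) - a * (u.2 * Q.bar v.1)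
      + Q.sqrtDiscr * m' * (u.2 * Q.bar v.2) := by
    simp only [skewForm]; ring
  rw [e]
  exact add_mem (sub_mem (add_mem
    (Ideal.mul_mem_left _ _ (Ideal.mul_mem_mul hu₁ hv₁))
    (Ideal.mul_mem_left _ _ (Ideal.mul_mem_mul hu₁ hv₂)))
    (Ideal.mul_mem_left _ _ (Ideal.mul_mem_mul hu₂ hv₁)))
    (Ideal.mul_mem_left _ _ (Ideal.mul_mem_mul hu₂ hv₂))

variable [IsDomain R] [CharZero R]

theorem exists_int_of_mul_eq_int (Q : QuadraticConjugation R) [IsIntegrallyClosed R] {g n : ℤ}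
    (hg : g ≠ 0) {x : R}
    (h : (g : R) * x = n) : ∃ k : ℤ, x = k := by
  refine Q.exists_int_of_bar_eq _ (mul_left_cancel₀ (Int.cast_ne_zero.2 hg : (g : R) ≠ 0) ?_)
  rw [h, ← map_intCast Q.bar g, ← map_mul, h, map_intCast]

/-- On the vectors with entries in an ideal `J` for which `J` times its conjugate is `(g)`, the
diagonal values of a skew-Hermitian form are divisible by `g δ`. -/
theorem exists_skewForm_self_of_mem [IsIntegrallyClosed R] (a : R) (m m' : ℤ) {w : R × R} {g : ℤ}
    (hg : g ≠ 0) {I J : Ideal R} (hIJ : I * J = Ideal.span {(g : R)})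
    (hw₁ : w.1 ∈ I) (hw₂ : w.2 ∈ I) (hw₁' : Q.bar w.1 ∈ J) (hw₂' : Q.bar w.2 ∈ J) :
    ∃ n : ℤ, Q.skewForm a m m' w w = g * Q.sqrtDiscr * n := by
  have key {x y : R} (hx : x ∈ I) (hy : y ∈ J) : (g : R) ∣ x * y :=
    Ideal.mem_span_singleton.1 (hIJ ▸ Ideal.mul_mem_mul hx hy)
  obtain ⟨x, hx⟩ := key hw₁ hw₁'
  obtain ⟨y, hy⟩ := key hw₁ hw₂'
  obtain ⟨z, hz⟩ := key hw₂ hw₂'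
  obtain ⟨n₁, hn₁⟩ := Q.exists_norm_eq_int w.1
  obtain ⟨n₂, hn₂⟩ := Q.exists_norm_eq_int w.2
  obtain ⟨p, rfl⟩ := Q.exists_int_of_mul_eq_int hg (hx.symm.trans hn₁)
  obtain ⟨q, rfl⟩ := Q.exists_int_of_mul_eq_int hg (hz.symm.trans hn₂)
  obtain ⟨r, hr⟩ := Q.exists_sub_bar (Q.bar a * y)
  rw [map_mul, Q.bar_bar] at hr
  have hy' := congrArg Q.bar hy
  rw [map_mul, map_mul, Q.bar_bar, map_intCast] at hy'
  refine ⟨m * p + r + m' * q, ?_⟩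
  push_cast
  simp only [skewForm]
  linear_combination Q.sqrtDiscr * m * hx + Q.bar a * hy - a * hy' + Q.sqrtDiscr * m' * hz + g * hr

/-- The coordinate ratio of two isotropic vectors, in terms of an integer fraction `y / q` in
lowest terms. -/
theorem exists_coprime_of_isotropic [IsIntegrallyClosed R] {X t : R} {g n : ℤ} (hg : g ≠ 0)
    (ht : t ≠ 0)
    (h : X * Q.bar t - Q.bar (X * Q.bar t) + t * Q.bar t * (g * Q.sqrtDiscr * n) = 0) :
    ∃ y q : ℤ, q ≠ 0 ∧ IsCoprime y q ∧
      (q : R) * X = g * t * (y - q * n * Q.gen) := by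
  obtain ⟨T, hT⟩ := Q.exists_norm_eq_int t
  have hT0 : T ≠ 0 := by
    rintro rfl
    simp [ht] at hT
  -- Since `gen - bar gen = δ`, the hypothesis says that adding gnT·`gen` to X·bar t cancels its
  -- skew part. The fraction y/q below is Y/(gT) in lowest terms.
  obtain ⟨Y, hY⟩ := Q.exists_int_of_bar_eq (X * Q.bar t + g * n * T * Q.gen) (by
    rw [map_add, map_mul _ _ Q.gen]
    simp only [map_mul _ _ (T : R), map_mul _ _ (n : R), map_intCast]
    rw [hT] at h
    linear_combination -h - (T * g * n : R) * Q.gen_sub_bar)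
  obtain ⟨y, q, hcop, hyq⟩ : ∃ y q : ℤ, IsCoprime y q ∧ Y * q = y * (g * T) := by
    have hd : gcd Y (g * T) ≠ 0 := by
      intro h0
      exact mul_ne_zero hg hT0 ((gcd_eq_zero_iff _ _).1 h0).2
    obtain ⟨y, hy⟩ := gcd_dvd_left Y (g * T)
    obtain ⟨q, hq⟩ := gcd_dvd_right Y (g * T)
    refine ⟨y, q, ?_, ?_⟩
    · obtain ⟨r, s, hrs⟩ := exists_gcd_eq_mul_add_mul Y (g * T)
      refine ⟨r, s, mul_left_cancel₀ hd ?_⟩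
      linear_combination -r * hy - s * hq - hrs
    · linear_combination q * hy - y * hq
  have hq0 : q ≠ 0 := by
    rintro rfl
    have : y = 0 := by simpa [hg, hT0] using hyq.symm
    subst this
    exact (isCoprime_zero_left.1 hcop).ne_zero rfl
  refine ⟨y, q, hq0, hcop, mul_left_cancel₀ (Int.cast_ne_zero.2 hT0 : (T : R) ≠ 0) ?_⟩
  have hyq' := congrArg (Int.cast : ℤ → R) hyq
  push_cast at hyq'
  linear_combination (t * q : R) * hY - (q : R) * X * hT + t * hyq'

end QuadraticConjugation

/-! ### Comparison of the ideals of two isotropic vectors. -/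

namespace QuadraticConjugation

variable {R : Type*} [CommRing R] (Q : QuadraticConjugation R)

theorem contentIdeal_ne_bot {u : R × R} (hu : u ≠ 0) : contentIdeal u ≠ ⊥ := by
  intro h
  rw [contentIdeal, Ideal.span_eq_bot] at h
  exact hu (Prod.ext (h _ (by simp)) (h _ (by simp)))

variable [IsDedekindDomain R] [Module.Free ℤ R] [Module.Finite ℤ R]

theorem absNorm_span_bar (x : R) :
    Ideal.absNorm (Ideal.span {Q.bar x}) = Ideal.absNorm (Ideal.span {x}) := by
  rw [← Q.absNorm_map_bar (Ideal.span {x}), Ideal.map_span, Set.image_singleton]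

theorem absNorm_span_intCast (hrank : Module.finrank ℤ R = 2) (n : ℤ) :
    Ideal.absNorm (Ideal.span {(n : R)}) = n.natAbs ^ 2 := by
  rw [Ideal.absNorm_span_singleton, ← eq_intCast (algebraMap ℤ R), Algebra.norm_algebraMap, hrank,
    Int.natAbs_pow]

/-- An element `k` of the square of `I` of norm `g² D`, where `I` times its conjugate `J` is `(g)`,
satisfies `k J = g 𝔟 I` for an ideal `𝔟` of norm `D`. -/
theorem exists_ideal_of_norm_eq [CharZero R] (hrank : Module.finrank ℤ R = 2) {u : R × R} {g : ℤ}
    (hg : g ≠ 0)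
    (hIJ : contentIdeal u * contentIdeal (Q.barVec u) = Ideal.span {(g : R)}) {k : R}
    (hk : k ∈ contentIdeal u * contentIdeal u) {D : ℕ} (hkD : k * Q.bar k = (g ^ 2 * D : ℤ)) :
    ∃ B : Ideal R, Ideal.absNorm B = D ∧
      Ideal.span {k} * contentIdeal (Q.barVec u) = Ideal.span {(g : R)} * (B * contentIdeal u) := by
  set I := contentIdeal u
  set J := contentIdeal (Q.barVec u) with hJ
  have hgR : (g : R) ≠ 0 := Int.cast_ne_zero.2 hg
  have hspan : Ideal.span {(g : R)} ≠ ⊥ := by simpa using hgR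
  have hJ0 : J ≠ 0 := by
    intro h
    rw [h, mul_zero] at hIJ
    exact hspan hIJ.symm
  -- As k lies in I², the ideal kJ² lies in (IJ)² = (g)². Taking norms of the quotient gives N(B) =
  -- g²D·g²/g⁴.
  obtain ⟨B, hB⟩ : Ideal.span {(g : R)} * Ideal.span {(g : R)} ∣ Ideal.span {k} * (J * J) := by
    rw [Ideal.dvd_iff_le, ← hIJ]
    calc Ideal.span {k} * (J * J) ≤ (I * I) * (J * J) :=
          Ideal.mul_mono_left ((Ideal.span_singleton_le_iff_mem _).2 hk)
      _ = _ := by ring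
  refine ⟨B, ?_, ?_⟩
  · have hJn : Ideal.absNorm J = Ideal.absNorm I := by
      rw [hJ, contentIdeal_barVec, absNorm_map_bar]
    have hIJn : Ideal.absNorm J * Ideal.absNorm J = g.natAbs ^ 2 := by
      rw [← absNorm_span_intCast hrank g, ← hIJ, map_mul, hJn]
    have hkn : Ideal.absNorm (Ideal.span {k}) = g.natAbs ^ 2 * D := by
      have h := congrArg (fun x => Ideal.absNorm (Ideal.span {x})) hkD
      simp only [absNorm_span_intCast hrank, ← Ideal.span_singleton_mul_span_singleton, map_mul,
        absNorm_span_bar] at h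
      rw [← pow_two] at h
      have := Nat.pow_left_injective (n := 2) (by norm_num) h
      simpa [Int.natAbs_mul, Int.natAbs_pow] using this
    have h := congrArg Ideal.absNorm hB
    simp only [map_mul, absNorm_span_intCast hrank, hIJn, hkn] at h
    have h0 : 0 < g.natAbs := Int.natAbs_pos.2 hg
    refine Nat.eq_of_mul_eq_mul_left (by positivity : 0 < g.natAbs ^ 2 * g.natAbs ^ 2) ?_
    rw [← h]; ring
  · refine mul_right_cancel₀ hspan (mul_right_cancel₀ hJ0 ?_)
    calc Ideal.span {k} * J * Ideal.span {(g : R)} * J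
        = Ideal.span {k} * (J * J) * Ideal.span {(g : R)} := by ring
      _ = Ideal.span {(g : R)} * Ideal.span {(g : R)} * B * (I * J) := by rw [hB, hIJ]
      _ = _ := by ring

/-- The content ideals of two isotropic vectors of a skew-Hermitian form of determinant `D` agree
in the class group up to primes whose norm divides `D`. -/
theorem exists_contentIdeal_relation [CharZero R] (hrank : Module.finrank ℤ R = 2) {a : R}
    {m m' : ℤ} {D : ℕ} (hD : D ≠ 0) (hdet : a * Q.bar a + Q.sqrtDiscr ^ 2 * m * m' = D)
    {u v : R × R} (hu : u ≠ 0) (hv : v ≠ 0) (huu : Q.skewForm a m m' u u = 0)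
    (hvv : Q.skewForm a m m' v v = 0) :
    ∃ (x y : R) (G : Ideal R), x ≠ 0 ∧ y ≠ 0 ∧ G ≠ ⊥ ∧
      (∀ P : Ideal R, P.IsPrime → G ≤ P → Ideal.absNorm P ∣ D) ∧
      Ideal.span {x} * contentIdeal v = Ideal.span {y} * (contentIdeal u * G) := by
  -- Proportional vectors have the same class, with G the unit ideal.
  by_cases ht : cross u v = 0
  · have key (x y : R) (hx : x ≠ 0) (hy : y ≠ 0) (h : x • v = y • u) :
        ∃ (x y : R) (G : Ideal R), x ≠ 0 ∧ y ≠ 0 ∧ G ≠ ⊥ ∧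
      (∀ P : Ideal R, P.IsPrime → G ≤ P → Ideal.absNorm P ∣ D) ∧
      Ideal.span {x} * contentIdeal v = Ideal.span {y} * (contentIdeal u * G) := by
      refine ⟨x, y, ⊤, hx, hy, top_ne_bot, fun P hP h => absurd (top_le_iff.1 h) hP.ne_top, ?_⟩
      rw [Ideal.mul_top, ← contentIdeal_smul, h, contentIdeal_smul]
    have hc : u.1 * v.2 = u.2 * v.1 := sub_eq_zero.1 ht
    by_cases h1 : u.1 = 0
    · have h2 : u.2 ≠ 0 := fun h => hu (Prod.ext h1 h)
      have hv1 : v.1 = 0 := by simpa [h1, h2] using hc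
      have hv2 : v.2 ≠ 0 := fun h => hv (Prod.ext hv1 h)
      exact key u.2 v.2 h2 hv2 (Prod.ext (by simp [h1, hv1]) (by simp [mul_comm]))
    · have hv1 : v.1 ≠ 0 := fun h =>
        hv (Prod.ext h (by simpa [h, h1] using hc))
      exact key u.1 v.1 h1 hv1 (Prod.ext (by simp [mul_comm]) (by simp [hc, mul_comm]))
  obtain ⟨g, hg, hIJ⟩ := Q.exists_contentIdeal_mul_bar hu
  have hgR : (g : R) ≠ 0 := Int.cast_ne_zero.2 hg
  obtain ⟨w, hw₁, hw₂, hw⟩ := exists_cross_eq (u := u) (J := contentIdeal (Q.barVec u))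
    (g := (g : R)) (hIJ ▸ Ideal.mem_span_singleton_self _)
  have hw₁' := Q.bar_mem_contentIdeal hw₁
  have hw₂' := Q.bar_mem_contentIdeal hw₂
  set k := Q.skewForm a m m' u w with hk
  have hkI : k ∈ contentIdeal u * contentIdeal u :=
    Q.skewForm_mem a m m' (fst_mem_contentIdeal u) (snd_mem_contentIdeal u) hw₁' hw₂'
  -- The Gram determinant of u and w is g²D, and u contributes a zero diagonal entry.
  have hkD : k * Q.bar k = (g ^ 2 * D : ℤ) := by
    have := Q.skewForm_gram a m m' u w
    rw [huu, hdet, hw, map_intCast] at this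
    rw [Q.bar_skewForm]
    push_cast
    linear_combination this
  obtain ⟨B, hB, hBI⟩ := Q.exists_ideal_of_norm_eq hrank hg hIJ hkI hkD
  obtain ⟨n, hn⟩ := Q.exists_skewForm_self_of_mem a m m' hg ((mul_comm _ _).trans hIJ)
    hw₁ hw₂ hw₁' hw₂'
  have hgv := smul_eq_cross_smul_add u v w
  rw [hw] at hgv
  have hzero : Q.skewForm a m m' ((g : R) • v) ((g : R) • v) = 0 := by
    rw [skewForm_smul_smul, hvv, mul_zero]
  rw [hgv, skewForm_smul_add, huu, hn, ← hk] at hzero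
  -- The isotropy of gv, expanded in u and w, determines the ratio of its two coordinates up to a
  -- rational number.
  obtain ⟨y, q, hq, hcop, hyq⟩ := Q.exists_coprime_of_isotropic (X := cross v w * k)
    (t := cross u v) (n := n) hg ht (by
      have e : cross v w * k * Q.bar (cross u v) = cross v w * Q.bar (cross u v) * k := by ring
      rw [e]
      linear_combination hzero)
  have hqR : (q : R) ≠ 0 := Int.cast_ne_zero.2 hq
  have hk0 : k ≠ 0 := by
    intro h
    rw [h, zero_mul] at hkD
    have : (g ^ 2 * D : ℤ) = 0 := by exact_mod_cast hkD.symm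
    simp [hg, hD] at this
  set G : Ideal R := Ideal.span {(y - q * n * Q.gen : R)} ⊔ Ideal.span {(q : R)} * B with hG
  have hrel : Ideal.span {(q * k : R)} * contentIdeal v =
      Ideal.span {cross u v} * (contentIdeal u * G) := by
    have hspan : Ideal.span {(g : R)} ≠ 0 := by simpa using hgR
    refine mul_left_cancel₀ hspan ?_
    have h1 := span_cross_mul_contentIdeal (v := v) hIJ hw₁ hw₂ hw
    calc Ideal.span {(g : R)} * (Ideal.span {(q * k : R)} * contentIdeal v)
        = Ideal.span {(q * k : R)} * (Ideal.span {(g : R)} * contentIdeal v) := by ring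
      _ = Ideal.span {(q * k : R)} * (Ideal.span {cross v w} * contentIdeal u)
          + Ideal.span {(q * k : R)} * (Ideal.span {cross u v} * contentIdeal (Q.barVec u)) := by
        rw [h1, ← Submodule.add_eq_sup, mul_add]
      _ = Ideal.span {(q * (cross v w * k) : R)} * contentIdeal u
          + Ideal.span {(q : R)} * Ideal.span {cross u v}
            * (Ideal.span {k} * contentIdeal (Q.barVec u)) := by
        simp only [← Ideal.span_singleton_mul_span_singleton]; ring
      _ = Ideal.span {(g * cross u v * (y - q * n * Q.gen) : R)} * contentIdeal u
          + Ideal.span {(q : R)} * Ideal.span {cross u v}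
            * (Ideal.span {(g : R)} * (B * contentIdeal u)) := by rw [hyq, hBI]
      _ = _ := by
        rw [hG, ← Submodule.add_eq_sup]
        simp only [← Ideal.span_singleton_mul_span_singleton]; ring
  refine ⟨q * k, cross u v, G, mul_ne_zero hqR hk0, ht, ?_, ?_, hrel⟩
  · intro h
    rw [h, Ideal.mul_bot, Ideal.mul_bot, Ideal.mul_eq_bot] at hrel
    rcases hrel with h | h
    · exact mul_ne_zero hqR hk0 (by simpa using h)
    · exact contentIdeal_ne_bot hv h
  · intro P hP hGP
    have hy : (y - q * n * Q.gen : R) ∈ P :=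
      hGP (Submodule.mem_sup_left (Ideal.mem_span_singleton_self _))
    -- If q were in P, then y would be too, against coprimality. Hence P contains B.
    rcases (hP.mul_le.1 (le_sup_right.trans hGP : Ideal.span {(q : R)} * B ≤ P)) with h | h
    · exfalso
      have hqP : (q : R) ∈ P := h (Ideal.mem_span_singleton_self _)
      have hyP : (y : R) ∈ P := by
        have := add_mem hy (Ideal.mul_mem_right (n * Q.gen : R) _ hqP)
        convert! this using 1
        ring
      obtain ⟨r, s, hrs⟩ := hcop
      refine hP.ne_top ((Ideal.eq_top_iff_one _).2 ?_)
      have hrs' := congrArg (Int.cast : ℤ → R) hrs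
      push_cast at hrs'
      rw [← hrs']
      exact add_mem (Ideal.mul_mem_left _ _ hyP) (Ideal.mul_mem_left _ _ hqP)
    · exact hB ▸ Ideal.absNorm_dvd_absNorm_of_le h

end QuadraticConjugation

/-! ### Metric estimates for oriented circles. -/

namespace OrientedCircle

/-- The value at `z` of the equation of the circle `C`. -/
noncomputable def equation (C : OrientedCircle) (z : ℂ) : ℝ :=
  C.curvature * ‖z‖ ^ 2 - 2 * (conj z * C.center).re + C.cocurvature

theorem coe_mem_points {C : OrientedCircle} {z : ℂ} :
    (z : OnePoint ℂ) ∈ C.points ↔ C.equation z = 0 := by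
  simp [points, equation]

theorem infty_mem_points {C : OrientedCircle} :
    (OnePoint.infty : OnePoint ℂ) ∈ C.points ↔ C.curvature = 0 := by
  simp [points]

/-- Completing the square: for r ≠ 0 the circle has centre ζ/r and radius 1/|r|. -/
theorem sq_norm_curvature_mul_sub_center (C : OrientedCircle) (z : ℂ) :
    ‖C.curvature * z - C.center‖ ^ 2 = C.curvature * C.equation z + 1 := by
  have h := C.norm_sq_eq
  rw [Complex.sq_norm, Complex.normSq_apply] at h
  rw [equation, Complex.sq_norm, Complex.sq_norm, Complex.normSq_apply, Complex.normSq_apply]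
  simp
  linear_combination h

theorem norm_curvature_mul_sub_center {C : OrientedCircle} {z : ℂ} (h : C.equation z = 0) :
    ‖C.curvature * z - C.center‖ = 1 := by
  have := C.sq_norm_curvature_mul_sub_center z
  rw [h, mul_zero, zero_add] at this
  exact (pow_eq_one_iff_of_nonneg (norm_nonneg _) two_ne_zero).1 this

/-- Two points on a circle of curvature `r` are at distance at most `2 / |r|`. -/
theorem norm_sub_le_two_div {C : OrientedCircle} {z w : ℂ} (hr : C.curvature ≠ 0)
    (hz : C.equation z = 0) (hw : C.equation w = 0) : ‖z - w‖ ≤ 2 / |C.curvature| := by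
  rw [le_div_iff₀ (abs_pos.2 hr), mul_comm, ← Real.norm_eq_abs, ← Complex.norm_real, ← norm_mul]
  calc ‖(C.curvature : ℂ) * (z - w)‖
      = ‖(C.curvature * z - C.center) - (C.curvature * w - C.center)‖ := by ring_nf
    _ ≤ 1 + 1 := (norm_sub_le _ _).trans
        (by rw [norm_curvature_mul_sub_center hz, norm_curvature_mul_sub_center hw])
    _ = 2 := by norm_num

/-- Near a point of the circle its equation is small. -/
theorem abs_equation_le {C : OrientedCircle} {z w : ℂ} (hw : C.equation w = 0) :
    |C.equation z| ≤ |C.curvature| * ‖w - z‖ ^ 2 + 2 * ‖w - z‖ := by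
  -- The exact Taylor expansion of the equation about w, whose gradient there has norm 2.
  have e : C.equation z = C.curvature * ‖w - z‖ ^ 2
      + -(2 * (conj (w - z) * (C.curvature * w - C.center)).re) := by
    rw [← sub_zero (C.equation z), ← hw]
    simp only [equation, Complex.sq_norm, Complex.normSq_apply]
    simp
    ring
  rw [e]
  refine (abs_add_le _ _).trans ?_
  gcongr
  · rw [abs_mul, abs_of_nonneg (sq_nonneg ‖w - z‖)]
  · rw [abs_neg, abs_mul, abs_two]
    gcongr
    refine (Complex.abs_re_le_norm _).trans ?_
    rw [norm_mul, norm_curvature_mul_sub_center hw, mul_one, RCLike.norm_conj]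

/-- A circle of nonzero curvature has a point whose distance to `z` is controlled by the value of
its equation at `z`. -/
theorem exists_equation_eq_zero_norm_le (C : OrientedCircle) (hr : C.curvature ≠ 0) (z : ℂ) :
    ∃ w, C.equation w = 0 ∧
      |C.curvature| * ‖w - z‖ ≤ 1 + √(|C.curvature| * |C.equation z| + 1) := by
  have hrc : (C.curvature : ℂ) ≠ 0 := by exact_mod_cast hr
  -- Any point of the circle would do; this one is a radius to the right of or left of the centre.
  refine ⟨(C.center + 1) / C.curvature, ?_, ?_⟩
  · have := C.sq_norm_curvature_mul_sub_center ((C.center + 1) / C.curvature)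
    rw [mul_div_cancel₀ _ hrc, add_sub_cancel_left, norm_one] at this
    have h : C.curvature * C.equation ((C.center + 1) / C.curvature) = 0 := by linarith
    exact (mul_eq_zero.1 h).resolve_left hr
  · rw [← Real.norm_eq_abs C.curvature, ← Complex.norm_real, ← norm_mul, mul_sub,
      mul_div_cancel₀ _ hrc]
    calc ‖C.center + 1 - C.curvature * z‖ = ‖1 - (C.curvature * z - C.center)‖ := by ring_nf
      _ ≤ ‖(1 : ℂ)‖ + ‖C.curvature * z - C.center‖ := norm_sub_le _ _
      _ ≤ _ := by
        rw [norm_one]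
        gcongr
        refine Real.le_sqrt_of_sq_le ?_
        rw [sq_norm_curvature_mul_sub_center]
        rw [Complex.norm_real, Real.norm_eq_abs, ← abs_mul]
        gcongr
        exact le_abs_self _

/-- The common points of two circles, one of them of nonzero curvature, are finite. -/
theorem exists_equation_eq_zero_of_inter {C C' : OrientedCircle} (hr : C.curvature ≠ 0)
    (h : (C.points ∩ C'.points).Nonempty) : ∃ z, C.equation z = 0 ∧ C'.equation z = 0 := by
  obtain ⟨p, hp, hp'⟩ := h
  induction p using OnePoint.rec with
  | infty => exact absurd (infty_mem_points.1 hp) hr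
  | coe z => exact ⟨z, coe_mem_points.1 hp, coe_mem_points.1 hp'⟩

end OrientedCircle

/-! ### Descent along chains of circles. -/

open OrientedCircle

/-- Along a chain of circles of curvature larger than `s`, one moves at most `2 / s` per step. -/
theorem exists_point_of_chain {c : ℕ → OrientedCircle} {z : ℂ} {s d : ℝ} (hs : 0 < s) {j : ℕ}
    (hlarge : ∀ k < j, s < |(c k).curvature|)
    (hmeet : ∀ k < j, ((c k).points ∩ (c (k + 1)).points).Nonempty)
    (h0 : ∃ w, (c 0).equation w = 0 ∧ ‖w - z‖ ≤ d) :
    ∃ w, (c j).equation w = 0 ∧ ‖w - z‖ ≤ d + j * (2 / s) := by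
  induction j with
  | zero => simpa using h0
  | succ j ih =>
    obtain ⟨w, hw, hwz⟩ := ih (fun k hk => hlarge k (by omega)) (fun k hk => hmeet k (by omega))
    have hl := hlarge j (by omega)
    have hr : (c j).curvature ≠ 0 := abs_pos.1 (hs.trans hl)
    obtain ⟨w', hw', hw''⟩ := exists_equation_eq_zero_of_inter hr (hmeet j (by omega))
    refine ⟨w', hw'', ?_⟩
    have h1 : ‖w' - w‖ ≤ 2 / s :=
      (OrientedCircle.norm_sub_le_two_div hr hw' hw).trans (by gcongr)
    have h2 := norm_sub_le_norm_sub_add_norm_sub w' w z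
    push_cast
    linarith

/-- In a finitely connected set of circles with discrete curvatures, a point that is approached by
small circles cannot have equations bounded away from zero. -/
theorem FinitelyConnected.exists_abs_equation_lt {A : Set OrientedCircle}
    (hA : FinitelyConnected A) {c₀ : ℝ} (hc : 0 < c₀)
    (hcurv : ∀ C ∈ A, ∃ m : ℕ, |C.curvature| = c₀ * m) {z : ℂ} {M : ℝ}
    (hM : ∀ B : ℝ, ∃ C ∈ A, B ≤ |C.curvature| ∧ |C.equation z| ≤ M) {ε : ℝ} (hε : 0 < ε) :
    ∃ C ∈ A, |C.equation z| < ε := by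
  obtain ⟨n, hn⟩ := hA
  by_contra! hlow
  -- With this δ, a circle of curvature below 1/δ with a point within δ(8n + 1) of z has equation
  -- less than ε at z.
  obtain ⟨δ, hδ, hδε⟩ : ∃ δ : ℝ, 0 < δ ∧ δ * (8 * n + 1) ^ 2 + 2 * (δ * (8 * n + 1)) < ε := by
    refine ⟨ε / (2 * ((8 * n + 1) ^ 2 + 2 * (8 * n + 1))), by positivity, ?_⟩
    have h : (0 : ℝ) < 8 * n + 1 := by positivity
    generalize (8 * n + 1 : ℝ) = x at h ⊢
    have e : ε / (2 * (x ^ 2 + 2 * x)) * x ^ 2 + 2 * (ε / (2 * (x ^ 2 + 2 * x)) * x) = ε / 2 := by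
      field_simp
    rw [e]
    linarith
  -- circles of curvature at least `1 / δ` close to `z`
  let good : OrientedCircle → Prop := fun C => C ∈ A ∧ 1 / δ ≤ |C.curvature| ∧
    ∃ w, C.equation w = 0 ∧ ‖w - z‖ ≤ δ + 4 * n / |C.curvature|
  have hstart : ∃ C, good C := by
    -- The second threshold forces √(r|M| + 1) ≤ rδ - 1 for r the absolute curvature, which places a
    -- point of the circle within δ of z.
    obtain ⟨C, hC, hr, hCM⟩ := hM (max (1 / δ) ((|M| + 5) / δ ^ 2 + 2 / δ))
    have h1 := (le_max_left _ _).trans hr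
    have h2 := (le_max_right _ _).trans hr
    have hpos : 0 < |C.curvature| := lt_of_lt_of_le (by positivity) h1
    obtain ⟨w, hw, hwz⟩ := C.exists_equation_eq_zero_norm_le (abs_pos.1 hpos) z
    refine ⟨C, hC, h1, w, hw, ?_⟩
    have h3 : ‖w - z‖ ≤ δ := by
      refine le_of_mul_le_mul_left (hwz.trans ?_) hpos
      generalize |C.curvature| = r at *
      have hr1 : 1 ≤ δ * r := by rwa [div_le_iff₀' hδ] at h1
      have hr2 : |M| + 5 + 2 * δ ≤ δ ^ 2 * r := by
        have := mul_le_mul_of_nonneg_left h2 (sq_nonneg δ)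
        have e : δ ^ 2 * ((|M| + 5) / δ ^ 2 + 2 / δ) = |M| + 5 + 2 * δ := by field_simp
        linarith
      have hr3 : 2 ≤ r * δ := by
        by_contra! hlt
        nlinarith [abs_nonneg M]
      have hsq : √(r * |C.equation z| + 1) ≤ r * δ - 1 := by
        refine Real.sqrt_le_iff.2 ⟨by linarith, ?_⟩
        have hm : r * |C.equation z| ≤ r * |M| :=
          mul_le_mul_of_nonneg_left (hCM.trans (le_abs_self M)) hpos.le
        nlinarith
      linarith
    have : (0 : ℝ) ≤ 4 * n / |C.curvature| := by positivity
    linarith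
  -- take one of least curvature
  have hmin : ∃ C, good C ∧ ∀ C', good C' → |C.curvature| ≤ |C'.curvature| := by
    obtain ⟨C₁, hC₁⟩ := hstart
    choose! f hf using hcurv
    obtain ⟨C, hC, hmin⟩ := (measure f).wf.has_min {C | good C} ⟨C₁, hC₁⟩
    refine ⟨C, hC, fun C' hC' => ?_⟩
    rw [hf C hC.1, hf C' hC'.1]
    have : f C ≤ f C' := not_lt.1 (hmin C' hC')
    gcongr
  obtain ⟨C, ⟨hCA, hCr, hCw⟩, hCmin⟩ := hmin
  have hpos : 0 < |C.curvature| := lt_of_lt_of_le (by positivity) hCr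
  obtain ⟨c, hc0, hcA, hcmeet, hcn⟩ := hn C hCA (abs_pos.1 hpos)
  have hex : ∃ j, |(c j).curvature| ≤ |C.curvature| / 2 := ⟨n, hcn⟩
  classical
  -- Stop the first time the curvature is halved. Each earlier circle has diameter less than 4/|r|,
  -- so the chain has drifted by at most 4n/|r|.
  let j := Nat.find hex
  have hj : |(c j).curvature| ≤ |C.curvature| / 2 := Nat.find_spec hex
  have hjn : j ≤ n := Nat.find_min' hex hcn
  obtain ⟨w, hw, hwz⟩ := exists_point_of_chain (c := c) (j := j) (s := |C.curvature| / 2)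
    (by positivity) (fun k hk => not_le.1 (Nat.find_min hex hk)) (fun k hk => hcmeet k (by omega))
    (by rw [hc0]; exact hCw)
  have hwz' : ‖w - z‖ ≤ δ + 8 * n / |C.curvature| := by
    refine hwz.trans ?_
    have e : (j : ℝ) * (2 / (|C.curvature| / 2)) = 4 * j / |C.curvature| := by field_simp; ring
    have h : 4 * (j : ℝ) / |C.curvature| ≤ 4 * n / |C.curvature| := by gcongr
    have e' : 8 * n / |C.curvature| = 4 * n / |C.curvature| + 4 * n / |C.curvature| := by ring
    linarith
  -- If the new curvature r' is still large, |r'| ≤ |r|/2 gives 8n/|r| ≤ 4n/|r'|. The new circle is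
  -- then good, against minimality.
  by_cases hbig : 1 / δ ≤ |(c j).curvature|
  · have hj0 : 0 < |(c j).curvature| := lt_of_lt_of_le (by positivity) hbig
    have := hCmin (c j) ⟨hcA j hjn, hbig, w, hw, hwz'.trans ?_⟩
    · linarith
    · gcongr δ + ?_
      rw [div_le_div_iff₀ hpos hj0]
      have : (0 : ℝ) ≤ n := n.cast_nonneg
      nlinarith
  · push Not at hbig
    have hle : ‖w - z‖ ≤ δ * (8 * n + 1) := by
      refine hwz'.trans ?_
      have : 8 * n / |C.curvature| ≤ 8 * n * δ := by
        rw [div_le_iff₀ hpos, mul_assoc]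
        rw [div_le_iff₀' hδ] at hCr
        exact le_mul_of_one_le_right (by positivity) hCr
      linarith
    refine (hlow (c j) (hcA j hjn)).not_gt (lt_of_le_of_lt (abs_equation_le hw) ?_)
    refine lt_of_le_of_lt ?_ hδε
    have h1 : |(c j).curvature| * ‖w - z‖ ^ 2 ≤ 1 / δ * (δ * (8 * n + 1)) ^ 2 := by gcongr
    have e : 1 / δ * (δ * (8 * n + 1)) ^ 2 = δ * (8 * n + 1) ^ 2 := by field_simp
    linarith

/-! ### Complex conjugation on the integers of an imaginary quadratic field. -/

open NumberField in
/-- The integers of an imaginary quadratic field with complex conjugation. -/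
theorem exists_quadraticConjugation {K : Type*} [Field K] [NumberField K]
    (hdeg : Module.finrank ℚ K = 2) (himag : NumberField.IsTotallyComplex K) (σ : K →+* ℂ) :
    ∃ Q : QuadraticConjugation (𝓞 K), (∀ z : 𝓞 K, σ (Q.bar z : 𝓞 K) = conj (σ (z : K))) ∧
      ∃ s : ℤ, s * s = 1 ∧
        σ (Q.sqrtDiscr : 𝓞 K) = s * (Complex.I * (√(|(NumberField.discr K : ℝ)|) : ℝ)) := by
  have : Algebra.IsQuadraticExtension ℚ K := ⟨hdeg⟩
  obtain ⟨ρ, hρ⟩ := ComplexEmbedding.exists_comp_symm_eq_of_comp_eq (k := ℚ) σ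
    (ComplexEmbedding.conjugate σ) (by ext; simp)
  set τ : K ≃ₐ[ℚ] K := ρ.symm with hτ
  have hστ (x : K) : σ (τ x) = conj (σ x) := RingHom.congr_fun hρ x
  have hττ (x : K) : τ (τ x) = x := σ.injective (by rw [hστ, hστ, Complex.conj_conj])
  have hτ1 : τ ≠ 1 := by
    intro h
    have hreal : ComplexEmbedding.IsReal σ := by
      ext x
      rw [ComplexEmbedding.conjugate_coe_eq, ← hστ, h]
      rfl
    exact (InfinitePlace.isComplex_mk_iff.1 (himag.isComplex (InfinitePlace.mk σ))) hreal
  have hcard : Fintype.card (K ≃ₐ[ℚ] K) = 2 := by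
    rw [← Nat.card_eq_fintype_card, IsGalois.card_aut_eq_finrank, hdeg]
  classical
  have huniv : (Finset.univ : Finset (K ≃ₐ[ℚ] K)) = {1, τ} := by
    symm
    apply Finset.eq_univ_of_card
    rw [hcard, Finset.card_pair hτ1.symm]
  have htr (x : K) : algebraMap ℚ K (Algebra.trace ℚ K x) = x + τ x := by
    rw [trace_eq_sum_automorphisms, huniv, Finset.sum_pair hτ1.symm]
    rfl
  let bar : 𝓞 K ≃+* 𝓞 K := RingOfIntegers.mapRingEquiv τ
  have hbar (z : 𝓞 K) : ((bar z : 𝓞 K) : K) = τ z := rfl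
  have hbarbar (z : 𝓞 K) : bar (bar z) = z := RingOfIntegers.ext (hττ z)
  have hfix (z : 𝓞 K) (hz : bar z = z) : ∃ n : ℤ, z = n := by
    have hz' : τ z = z := congrArg (fun x : 𝓞 K => (x : K)) hz
    obtain ⟨q, hq⟩ := (IsGalois.mem_range_algebraMap_iff_fixed (F := ℚ) (E := K) (z : K)).2 (by
      intro f
      have : f ∈ ({1, τ} : Finset (K ≃ₐ[ℚ] K)) := huniv ▸ Finset.mem_univ f
      rcases Finset.mem_insert.1 this with rfl | h
      · rfl
      · rw [Finset.mem_singleton.1 h, hz'])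
    have hint : IsIntegral ℤ q := by
      rw [← isIntegral_algebraMap_iff (algebraMap ℚ K).injective, hq]
      exact z.isIntegral_coe
    obtain ⟨n, hn⟩ := IsIntegrallyClosed.isIntegral_iff.1 hint
    refine ⟨n, RingOfIntegers.ext ?_⟩
    rw [← hq, ← hn]
    simp
  have hrank : Module.finrank ℤ (𝓞 K) = 2 := (RingOfIntegers.rank K).trans hdeg
  let b : Module.Basis (Fin 2) ℤ (𝓞 K) := Module.finBasisOfFinrankEq ℤ (𝓞 K) hrank
  -- The determinant of the basis and its conjugate, so its square is the discriminant.
  set δ : 𝓞 K := b 0 * bar (b 1) - b 1 * bar (b 0) with hδ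
  have hδ2 : (δ : K) ^ 2 = discr K := by
    have htr' (x : 𝓞 K) : ((Algebra.trace ℤ (𝓞 K) x : ℤ) : K) = x + τ x := by
      rw [← htr, ← Algebra.coe_trace_int]; simp
    rw [← discr_eq_discr K b, Algebra.discr_def, Matrix.det_fin_two]
    simp only [Algebra.traceMatrix_apply, Algebra.traceForm_apply]
    push_cast
    rw [htr', htr', htr', htr', hδ]
    simp only [map_mul, map_sub, hbar]
    ring
  have hrep (z : 𝓞 K) : z = b.repr z 0 * b 0 + b.repr z 1 * b 1 := by
    conv_lhs => rw [← b.sum_repr z]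
    simp [Fin.sum_univ_two]
  -- Written as z·bar 1 - bar z·1, the difference is δ times the determinant of the coordinates of z
  -- and 1.
  have hsub (z : 𝓞 K) : z - bar z =
      ((b.repr z 0 * b.repr 1 1 - b.repr z 1 * b.repr 1 0 : ℤ) : 𝓞 K) * δ := by
    have h1 := hrep 1
    have h1' := congrArg bar h1
    have h2 := hrep z
    have h2' := congrArg bar h2
    generalize b.repr z 0 = z₀ at *
    generalize b.repr z 1 = z₁ at *
    generalize b.repr 1 0 = e₀ at *
    generalize b.repr 1 1 = e₁ at *
    simp only [map_add, map_mul, map_intCast, map_one] at h1' h2'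
    calc z - bar z = z * 1 - bar z * 1 := by ring
      _ = (z₀ * b 0 + z₁ * b 1) * (e₀ * bar (b 0) + e₁ * bar (b 1))
          - (z₀ * bar (b 0) + z₁ * bar (b 1)) * (e₀ * b 0 + e₁ * b 1) := by
        rw [← h1, ← h1', ← h2, ← h2']
      _ = _ := by rw [hδ]; push_cast; ring
  -- The vector 1 is primitive in the lattice: a common divisor of its coordinates is a unit. The
  -- Bézout coefficients then give an element whose coordinate determinant with 1 is 1, namely
  -- `gen`.
  obtain ⟨r, s, hrs⟩ : IsCoprime (b.repr 1 0) (b.repr 1 1) := by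
    have h1 := hrep 1
    obtain ⟨x₀, hx₀⟩ := gcd_dvd_left (b.repr 1 0) (b.repr 1 1)
    obtain ⟨x₁, hx₁⟩ := gcd_dvd_right (b.repr 1 0) (b.repr 1 1)
    obtain ⟨r, s, hrs⟩ := exists_gcd_eq_mul_add_mul (b.repr 1 0) (b.repr 1 1)
    generalize b.repr 1 0 = e₀ at *
    generalize b.repr 1 1 = e₁ at *
    generalize gcd e₀ e₁ = d at *
    have hy : (d : 𝓞 K) * (x₀ * b 0 + x₁ * b 1) = 1 := by
      rw [h1, hx₀, hx₁]; push_cast; ring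
    have hd : (d : 𝓞 K) ≠ 0 := left_ne_zero_of_mul_eq_one hy
    obtain ⟨k, hk⟩ := hfix (x₀ * b 0 + x₁ * b 1) (mul_left_cancel₀ hd (by
      rw [hy, ← map_intCast bar d, ← map_mul, hy, map_one]))
    rw [hk] at hy
    have hdk : d * k = 1 := by exact_mod_cast hy
    exact ⟨k * r, k * s, by rw [← hdk, hrs]; ring⟩
  let Q : QuadraticConjugation (𝓞 K) :=
    { bar := bar
      bar_bar := hbarbar
      exists_int_of_bar_eq := hfix
      sqrtDiscr := δ
      sqrtDiscr_ne_zero := by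
        intro h
        rw [h] at hδ2
        have : (discr K : K) = 0 := by simpa using hδ2.symm
        exact discr_ne_zero K (by exact_mod_cast this)
      gen := (s : 𝓞 K) * b 0 - (r : 𝓞 K) * b 1
      gen_sub_bar := by
        have h0 := hsub (b 0)
        have h1 := hsub (b 1)
        simp at h0 h1
        have hrs' := congrArg (Int.cast : ℤ → 𝓞 K) hrs
        push_cast at hrs'
        simp only [map_sub, map_mul, map_intCast]
        linear_combination s * h0 - r * h1 + δ * hrs'
      exists_sub_bar := fun z => ⟨_, hsub z⟩ }
  refine ⟨Q, fun z => hστ z, ?_⟩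
  have hre : conj (σ δ) = -σ δ := by
    rw [← hστ, ← map_neg, hδ]
    congr 1
    simp only [map_sub, map_mul, hbar, hττ]
    ring
  have hre0 : (σ δ).re = 0 := by
    have := congrArg Complex.re hre
    simp at this
    linarith
  have him : σ δ = Complex.I * ((σ δ).im : ℝ) := by
    apply Complex.ext <;> simp [hre0]
  have hsq : (discr K : ℝ) = -(σ δ).im ^ 2 := by
    have h := congrArg σ hδ2
    rw [map_pow, him, map_intCast, mul_pow, Complex.I_sq] at h
    have h' := congrArg Complex.re h
    norm_cast at h'
    push_cast at h'
    linarith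
  have habs : √(|(discr K : ℝ)|) = |(σ δ).im| := by
    rw [hsq, abs_neg, abs_of_nonneg (sq_nonneg _), Real.sqrt_sq_eq_abs]
  change ∃ s : ℤ, s * s = 1 ∧ σ δ = s * (Complex.I * (√(|(NumberField.discr K : ℝ)|) : ℝ))
  rw [habs]
  rcases abs_choice (σ δ).im with h | h <;> rw [h]
  · exact ⟨1, by norm_num, by rw [Int.cast_one, one_mul]; exact him⟩
  · exact ⟨-1, by norm_num, by rw [him]; push_cast; simp⟩

/-! ### The dictionary between circles and skew-Hermitian forms. -/

open QuadraticConjugation OrientedCircle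

/-- The circle `C` is given by the skew-Hermitian form with entries `m δ`, `m' δ`, `a`. -/
structure OrientedCircle.IsOfForm {K : Type*} [Field K] [NumberField K]
    (Q : QuadraticConjugation (𝓞 K)) (σ : K →+* ℂ) (D : ℝ) (C : OrientedCircle) (a : 𝓞 K)
    (m m' : ℤ) : Prop where
  center_eq : Complex.I * (√D : ℝ) * C.center = σ (a : K)
  cocurvature_eq : Complex.I * (√D : ℝ) * C.cocurvature = σ (Q.sqrtDiscr : 𝓞 K) * m'
  curvature_eq : Complex.I * (√D : ℝ) * C.curvature = σ (Q.sqrtDiscr : 𝓞 K) * m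

section CircleArrangement

variable {K : Type*} [Field K] [NumberField K] {Q : QuadraticConjugation (𝓞 K)} {σ : K →+* ℂ}
  {D : ℝ} {C : OrientedCircle} {a : 𝓞 K} {m m' : ℤ}

theorem I_mul_sqrt_mul_conj (D : ℝ) (z : ℂ) :
    Complex.I * (√D : ℝ) * conj z = -conj (Complex.I * (√D : ℝ) * z) := by
  simp

theorem I_mul_sqrt_ne_zero (hD : 0 < D) : Complex.I * (√D : ℝ) ≠ 0 :=
  mul_ne_zero Complex.I_ne_zero (by simpa using (Real.sqrt_pos.2 hD).ne')

theorem I_mul_sqrt_sq (hD : 0 < D) : (Complex.I * (√D : ℝ)) ^ 2 = -(D : ℂ) := by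
  rw [mul_pow, Complex.I_sq, ← Complex.ofReal_pow, Real.sq_sqrt hD.le]; simp

theorem OrientedCircle.norm_sq_eq_complex (C : OrientedCircle) :
    C.center * conj C.center - C.cocurvature * C.curvature = (1 : ℂ) := by
  rw [Complex.mul_conj, ← Complex.sq_norm]
  exact_mod_cast C.norm_sq_eq

/-- The sign s is absorbed into the integers m and m'. The condition on the conjugate centre follows
from the one on the centre. -/
theorem mem_circleArrangement_iff (hbar : ∀ z : 𝓞 K, σ (Q.bar z : 𝓞 K) = conj (σ (z : K)))
    {s : ℤ} (hs : s * s = 1)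
    (hδ : σ (Q.sqrtDiscr : 𝓞 K) = s * (Complex.I * (√(|(NumberField.discr K : ℝ)|) : ℝ))) :
    C ∈ circleArrangement σ D ↔ ∃ a m m', C.IsOfForm Q σ D a m m' := by
  have hs' : (s : ℂ) * s = 1 := by exact_mod_cast hs
  constructor
  · rintro ⟨⟨a, ha⟩, -, ⟨m', hm'⟩, ⟨m, hm⟩⟩
    refine ⟨a, s * m, s * m', ha, ?_, ?_⟩
    · rw [hm', hδ]; push_cast
      linear_combination (-Complex.I * (√(|(NumberField.discr K : ℝ)|) : ℝ) * m') * hs'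
    · rw [hm, hδ]; push_cast
      linear_combination (-Complex.I * (√(|(NumberField.discr K : ℝ)|) : ℝ) * m) * hs'
  · rintro ⟨a, m, m', ha, hm', hm⟩
    refine ⟨⟨a, ha⟩, ⟨-Q.bar a, ?_⟩, ⟨s * m', ?_⟩, ⟨s * m, ?_⟩⟩
    · rw [I_mul_sqrt_mul_conj D, ha, ← hbar]; simp
    · rw [hm', hδ]; push_cast; ring
    · rw [hm, hδ]; push_cast; ring

namespace OrientedCircle.IsOfForm

theorem conj_center_eq (h : C.IsOfForm Q σ D a m m')
    (hbar : ∀ z : 𝓞 K, σ (Q.bar z : 𝓞 K) = conj (σ (z : K))) :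
    Complex.I * (√D : ℝ) * conj C.center = -σ (Q.bar a : 𝓞 K) := by
  rw [I_mul_sqrt_mul_conj D, h.center_eq, hbar]

/-- This is the normalisation |ζ|² - r̂r = 1 multiplied by -(i√D)² = D. -/
theorem det_eq (h : C.IsOfForm Q σ D a m m') (hD : 0 < D)
    (hbar : ∀ z : 𝓞 K, σ (Q.bar z : 𝓞 K) = conj (σ (z : K))) :
    σ ((a * Q.bar a + Q.sqrtDiscr ^ 2 * m * m' : 𝓞 K) : K) = D := by
  have h1 := h.conj_center_eq hbar
  have h2 := I_mul_sqrt_sq hD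
  have h3 := C.norm_sq_eq_complex
  simp only [map_add, map_mul, map_pow, map_intCast]
  rw [← neg_eq_iff_eq_neg.2 h1, ← h.center_eq]
  linear_combination -Complex.I * (√D : ℝ) * C.cocurvature * h.curvature_eq
    - σ (Q.sqrtDiscr : 𝓞 K) * m * h.cocurvature_eq - (Complex.I * (√D : ℝ)) ^ 2 * h3 - h2

theorem equation_eq (h : C.IsOfForm Q σ D a m m')
    (hbar : ∀ z : 𝓞 K, σ (Q.bar z : 𝓞 K) = conj (σ (z : K))) (u : 𝓞 K × 𝓞 K)
    (hu : u.2 ≠ 0) :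
    Complex.I * (√D : ℝ) * (σ u.2 * conj (σ u.2)) * C.equation (σ u.1 / σ u.2) =
      σ (Q.skewForm a m m' u u : 𝓞 K) := by
  have hu' : σ u.2 ≠ 0 := by simpa using hu
  have hu'' : conj (σ u.2) ≠ 0 := by simpa using hu
  have e (z : ℂ) : (C.equation z : ℂ) = C.curvature * (z * conj z)
      - (conj z * C.center + z * conj C.center) + C.cocurvature := by
    rw [equation, Complex.sq_norm]
    push_cast
    rw [← Complex.mul_conj]
    have h := Complex.add_conj (conj z * C.center)
    simp only [map_mul, Complex.conj_conj] at h
    push_cast at h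
    rw [h]
  have h1 := h.conj_center_eq hbar
  rw [e]
  simp only [skewForm, map_add, map_sub, map_mul, map_intCast, hbar, map_div₀]
  rw [← hbar a, ← h.center_eq, ← neg_eq_iff_eq_neg.2 h1, ← h.curvature_eq,
    mul_comm (σ (Q.sqrtDiscr : 𝓞 K)) (m' : ℂ), mul_comm (m' : ℂ), ← h.cocurvature_eq]
  field_simp
  ring

end OrientedCircle.IsOfForm

end CircleArrangement

/-! ### Parabolic deformation of a form. -/

namespace QuadraticConjugation

variable {R : Type*} [CommRing R] (Q : QuadraticConjugation R)

/-- The parabolic matrices fixing an anisotropic vector `u` carry a skew-Hermitian form to forms of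
the same determinant and the same value at `u`, whose first diagonal entry is arbitrarily large. -/
theorem exists_form_large [IsDomain R] [CharZero R] (a : R) (m m' : ℤ) {u : R × R}
    (hu : u.2 ≠ 0) (huu : Q.skewForm a m m' u u ≠ 0) (B : ℤ) :
    ∃ (a₁ : R) (m₁ m₁' : ℤ), B ≤ |m₁| ∧
      a₁ * Q.bar a₁ + Q.sqrtDiscr ^ 2 * m₁ * m₁' =
        a * Q.bar a + Q.sqrtDiscr ^ 2 * m * m' ∧
      Q.skewForm a₁ m₁ m₁' u u = Q.skewForm a m m' u u := by
  -- These are the images of the standard basis under the transvection x ↦ x + κ·det(u, x)·u, which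
  -- fixes u and has determinant 1.
  let v (κ : ℤ) : R × R := (1 - κ * u.2 * u.1, -κ * u.2 * u.2)
  let w (κ : ℤ) : R × R := (κ * u.1 * u.1, 1 + κ * u.1 * u.2)
  have hvw (κ : ℤ) : cross (v κ) (w κ) = 1 := by
    simp only [cross, v, w]; ring
  choose n hn using fun κ => Q.exists_skewForm_self a m m' (v κ)
  choose n' hn' using fun κ => Q.exists_skewForm_self a m m' (w κ)
  obtain ⟨h, hh⟩ := Q.exists_skewForm_self a m m' u
  obtain ⟨N, hN⟩ := Q.exists_norm_eq_int u.2
  have hNh : N * h ≠ 0 := by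
    refine mul_ne_zero ?_ ?_
    · rintro rfl
      simp [hu] at hN
    · rintro rfl
      simp [hh] at huu
  -- Adding the values at κ and -κ removes the linear term and leaves a quadratic with leading
  -- coefficient 2Nh ≠ 0.
  have hsum (κ : ℤ) : n κ + n (-κ) = 2 * m + 2 * κ ^ 2 * (N * h) := by
    have key : Q.skewForm a m m' (v κ) (v κ) + Q.skewForm a m m' (v (-κ)) (v (-κ)) =
        2 * (Q.sqrtDiscr * m) + 2 * κ ^ 2 * (u.2 * Q.bar u.2 * Q.skewForm a m m' u u) := by
      simp only [skewForm, v, map_sub, map_mul, map_neg, map_one, map_intCast, Int.cast_neg]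
      ring
    rw [hn, hn, hh, hN] at key
    have : (((n κ + n (-κ) : ℤ)) : R) = ((2 * m + 2 * κ ^ 2 * (N * h) : ℤ) : R) := by
      refine mul_left_cancel₀ Q.sqrtDiscr_ne_zero ?_
      push_cast
      linear_combination key
    exact_mod_cast this
  obtain ⟨κ, hκ⟩ : ∃ κ, B ≤ |n κ| := by
    by_contra! hlt
    set κ : ℤ := |B| + |m| + 1
    have h1 := abs_add_le (n κ) (n (-κ))
    have h2 := hlt κ
    have h3 := hlt (-κ)
    rw [hsum] at h1
    have h4 : |2 * κ ^ 2 * (N * h)| ≤ |2 * m + 2 * κ ^ 2 * (N * h)| + |2 * m| := by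
      have := abs_sub (2 * m + 2 * κ ^ 2 * (N * h)) (2 * m)
      rwa [add_sub_cancel_left] at this
    have h5 : 2 * κ ^ 2 ≤ |2 * κ ^ 2 * (N * h)| := by
      rw [abs_mul, abs_of_nonneg (by positivity : 0 ≤ 2 * κ ^ 2)]
      exact le_mul_of_one_le_right (by positivity) (Int.one_le_abs hNh)
    have h6 : |2 * m| = 2 * |m| := by rw [abs_mul, abs_two]
    have h7 : κ ≤ κ ^ 2 := by
      have : 1 ≤ κ := by have := abs_nonneg B; have := abs_nonneg m; omega
      nlinarith
    have := le_abs_self B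
    have := abs_nonneg m
    omega
  have hb : Q.bar (Q.skewForm a m m' (v κ) (w κ)) = -Q.skewForm a m m' (w κ) (v κ) :=
    Q.bar_skewForm a m m' _ _
  -- The conjugate appears because the upper off-diagonal entry of a form is `bar a`.
  refine ⟨Q.bar (Q.skewForm a m m' (v κ) (w κ)), n κ, n' κ, hκ, ?_, ?_⟩
  · have hgram := Q.skewForm_gram a m m' (v κ) (w κ)
    rw [hvw, map_one, hn, hn'] at hgram
    rw [Q.bar_bar, hb]
    linear_combination hgram
  · have hlin : Q.skewForm (Q.bar (Q.skewForm a m m' (v κ) (w κ))) (n κ) (n' κ) u u =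
        Q.skewForm a m m' (u.1 • v κ + u.2 • w κ) (u.1 • v κ + u.2 • w κ) := by
      rw [skewForm_smul_add, hn, hn', map_mul, hb]
      simp only [skewForm, Q.bar_bar, map_neg, map_mul]
      have hb' : Q.bar (Q.skewForm a m m' (w κ) (v κ)) = -Q.skewForm a m m' (v κ) (w κ) :=
        Q.bar_skewForm a m m' _ _
      simp only [skewForm] at hb'
      linear_combination (-u.1 * Q.bar u.2) * hb'
    have hfix : u.1 • v κ + u.2 • w κ = u := by
      ext <;> simp [v, w] <;> ring
    rw [hlin, hfix]

end QuadraticConjugation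

/-! ### Every finite point of the field lies on a circle of the arrangement. -/

section Covering

variable {K : Type*} [Field K] [NumberField K] {Q : QuadraticConjugation (𝓞 K)} {σ : K →+* ℂ}
  {D : ℝ} {C : OrientedCircle} {a : 𝓞 K} {m m' : ℤ}

/-- A purely imaginary δ makes the curvature and cocurvature real, and the determinant condition
becomes the normalisation of the circle. -/
theorem exists_isOfForm (hbar : ∀ z : 𝓞 K, σ (Q.bar z : 𝓞 K) = conj (σ (z : K)))
    (hD : 0 < D) {t : ℝ} (hδ : σ (Q.sqrtDiscr : 𝓞 K) = Complex.I * t)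
    (hdet : σ ((a * Q.bar a + Q.sqrtDiscr ^ 2 * m * m' : 𝓞 K) : K) = D) :
    ∃ C : OrientedCircle, C.IsOfForm Q σ D a m m' := by
  have h0 := I_mul_sqrt_ne_zero hD
  have hs : (√D : ℝ) ≠ 0 := (Real.sqrt_pos.2 hD).ne'
  have hsc : ((√D : ℝ) : ℂ) ≠ 0 := by exact_mod_cast hs
  have key : ‖σ (a : K) / (Complex.I * (√D : ℝ))‖ ^ 2 - t / √D * m' * (t / √D * m) = 1 := by
    have h1 : ‖σ (a : K)‖ ^ 2 - t ^ 2 * m * m' = D := by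
      simp only [map_add, map_mul, map_pow, map_intCast, hbar, Complex.mul_conj, hδ, mul_pow,
        Complex.I_sq] at hdet
      rw [Complex.sq_norm]
      have : ((Complex.normSq (σ (a : K)) - t ^ 2 * m * m' : ℝ) : ℂ) = (D : ℝ) := by
        rw [← hdet]; push_cast; ring
      exact_mod_cast this
    rw [norm_div, norm_mul, Complex.norm_I, one_mul, Complex.norm_real, Real.norm_eq_abs, div_pow,
      sq_abs, Real.sq_sqrt hD.le]
    have e : t / √D * m' * (t / √D * m) = t ^ 2 * m * m' / D := by
      rw [← Real.sq_sqrt hD.le, Real.sqrt_sq (Real.sqrt_nonneg D)]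
      field_simp
    rw [e, ← sub_div, h1, div_self hD.ne']
  refine ⟨⟨σ a / (Complex.I * (√D : ℝ)), t / √D * m', t / √D * m, key⟩, ?_, ?_, ?_⟩
  · exact mul_div_cancel₀ _ h0
  · simp only [hδ]; push_cast; field_simp
  · simp only [hδ]; push_cast; field_simp

/-- If the arrangement is finitely connected, each point of the field lies on one of its circles. -/
theorem FinitelyConnected.exists_isotropic
    (hbar : ∀ z : 𝓞 K, σ (Q.bar z : 𝓞 K) = conj (σ (z : K)))
    {A : Set OrientedCircle} (hA : ∀ C, C ∈ A ↔ ∃ a m m', C.IsOfForm Q σ D a m m')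
    (hD : 0 < D) {t : ℝ} (hδ : σ (Q.sqrtDiscr : 𝓞 K) = Complex.I * t) (hne : A.Nonempty)
    (hfin : FinitelyConnected A) {u : 𝓞 K × 𝓞 K} (hu : u.2 ≠ 0) :
    ∃ (C : OrientedCircle) (a : 𝓞 K) (m m' : ℤ), C.IsOfForm Q σ D a m m' ∧
      Q.skewForm a m m' u u = 0 := by
  by_contra! hno
  have hs : 0 < √D := Real.sqrt_pos.2 hD
  have ht : 0 < |t| := by
    refine abs_pos.2 ?_
    rintro rfl
    have : σ (Q.sqrtDiscr : 𝓞 K) = 0 := by simpa using hδ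
    exact Q.sqrtDiscr_ne_zero (by simpa using this)
  have hu' : 0 < ‖σ u.2‖ := by simpa using hu
  have heq {C : OrientedCircle} {a : 𝓞 K} {m m' : ℤ} (h : C.IsOfForm Q σ D a m m') :
      √D * ‖σ u.2‖ ^ 2 * |C.equation (σ u.1 / σ u.2)| = ‖σ (Q.skewForm a m m' u u : 𝓞 K)‖ := by
    rw [← h.equation_eq hbar u hu]
    simp [abs_of_nonneg hs.le, pow_two]
  have hcurv {C : OrientedCircle} {a : 𝓞 K} {m m' : ℤ} (h : C.IsOfForm Q σ D a m m') :
      |C.curvature| = |t| / √D * |(m : ℝ)| := by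
    have := congrArg norm h.curvature_eq
    rw [hδ] at this
    simp [abs_of_nonneg hs.le] at this
    field_simp
    linarith
  obtain ⟨C₀, hC₀⟩ := hne
  obtain ⟨a, m, m', h₀⟩ := (hA C₀).1 hC₀
  have hdet := h₀.det_eq hD hbar
  -- The parabolic deformations of C₀ have unbounded curvature and a constant equation value at z.
  -- The bound ε below is the least nonzero absolute value that H(u, u) ∈ δℤ allows that equation.
  obtain ⟨C, hC, hlt⟩ := hfin.exists_abs_equation_lt (c₀ := |t| / √D) (by positivity)
    (fun C hC => by
      obtain ⟨a, m, m', h⟩ := (hA C).1 hC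
      exact ⟨m.natAbs, by rw [hcurv h, Nat.cast_natAbs, Int.cast_abs]⟩)
    (z := σ u.1 / σ u.2) (M := |C₀.equation (σ u.1 / σ u.2)|)
    (fun B => by
      obtain ⟨a₁, m₁, m₁', hB, hdet₁, hval⟩ :=
        Q.exists_form_large a m m' hu (hno C₀ a m m' h₀) ⌈B / (|t| / √D)⌉
      obtain ⟨C, hC⟩ := exists_isOfForm hbar hD hδ (hdet₁ ▸ hdet)
      refine ⟨C, (hA C).2 ⟨_, _, _, hC⟩, ?_, ?_⟩
      · rw [hcurv hC]
        rw [← div_le_iff₀' (by positivity)]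
        exact (Int.le_ceil _).trans (by exact_mod_cast hB)
      · have h1 := heq hC
        rw [hval, ← heq h₀] at h1
        exact (mul_left_cancel₀ (by positivity) h1).le)
    (ε := |t| / (√D * ‖σ u.2‖ ^ 2)) (by positivity)
  obtain ⟨a, m, m', h⟩ := (hA C).1 hC
  obtain ⟨n, hn⟩ := Q.exists_skewForm_self a m m' u
  have hn0 : n ≠ 0 := by
    rintro rfl
    exact hno C a m m' h (by simp [hn])
  rw [lt_div_iff₀' (by positivity), heq h, hn] at hlt
  have : ‖σ ((Q.sqrtDiscr * n : 𝓞 K) : K)‖ = |t| * |(n : ℝ)| := by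
    simp [hδ]
  rw [this] at hlt
  have h1 : (1 : ℝ) ≤ |(n : ℝ)| := by exact_mod_cast Int.one_le_abs hn0
  nlinarith

end Covering

/-! ### Ideal classes of vectors. -/

section ClassGroup

variable {R : Type*} [CommRing R] [IsDedekindDomain R]

/-- The class of a nonzero ideal lies in a subgroup containing the classes of its prime factors. -/
theorem ClassGroup.mk0_mem_of_forall_prime {H : Subgroup (ClassGroup R)} (G : Ideal R)
    (hG : G ∈ (Ideal R)⁰)
    (h : ∀ (P : Ideal R) (hP : P ∈ (Ideal R)⁰), P.IsPrime → G ≤ P → ClassGroup.mk0 ⟨P, hP⟩ ∈ H) :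
    ClassGroup.mk0 ⟨G, hG⟩ ∈ H := by
  induction G using UniqueFactorizationMonoid.induction_on_prime with
  | h₁ => exact absurd rfl (mem_nonZeroDivisors_iff_ne_zero.1 hG)
  | h₂ I hI =>
    have : (⟨I, hG⟩ : (Ideal R)⁰) = 1 :=
      Subtype.ext ((Ideal.isUnit_iff.1 hI).trans Ideal.one_eq_top.symm)
    rw [this, map_one]
    exact one_mem H
  | h₃ I P hI hP ih =>
    have hP' : P ∈ (Ideal R)⁰ := mem_nonZeroDivisors_iff_ne_zero.2 hP.ne_zero
    have hI' : I ∈ (Ideal R)⁰ := mem_nonZeroDivisors_iff_ne_zero.2 hI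
    have : (⟨P * I, hG⟩ : (Ideal R)⁰) = ⟨P, hP'⟩ * ⟨I, hI'⟩ := rfl
    rw [this, map_mul]
    exact mul_mem (h P hP' (Ideal.isPrime_of_prime hP) Ideal.mul_le_left)
      (ih hI' fun P' hP' hprime hle => h P' hP' hprime (Ideal.mul_le_right.trans hle))

/-- The ideal class of the content of a nonzero vector. -/
noncomputable def vectorClass (u : R × R) (hu : u ≠ 0) : ClassGroup R :=
  ClassGroup.mk0 ⟨contentIdeal u, mem_nonZeroDivisors_iff_ne_zero.2 (contentIdeal_ne_bot hu)⟩

/-- An ideal of a Dedekind domain has two generators, one of them any chosen nonzero element.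
Placing that one second makes the vector represent a finite point. -/
theorem exists_vectorClass_eq (x : ClassGroup R) :
    ∃ (u : R × R) (h : u.2 ≠ 0), vectorClass u (fun h' => h (by simp [h'])) = x := by
  obtain ⟨⟨I, hI⟩, rfl⟩ := ClassGroup.mk0_surjective x
  obtain ⟨y, hyI, hy⟩ := Submodule.exists_mem_ne_zero_of_ne_bot
    (mem_nonZeroDivisors_iff_ne_zero.1 hI)
  obtain ⟨z, hz⟩ := IsDedekindDomain.exists_eq_span_pair hyI hy
  refine ⟨(z, y), hy, ?_⟩
  rw [vectorClass]
  congr 2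
  rw [hz, contentIdeal, Set.pair_comm]

theorem vectorClass_zero_one : vectorClass ((0, 1) : R × R) (by simp) = 1 := by
  have : (⟨contentIdeal ((0, 1) : R × R), mem_nonZeroDivisors_iff_ne_zero.2
      (contentIdeal_ne_bot (by simp))⟩ : (Ideal R)⁰) = 1 :=
    Subtype.ext (((Ideal.eq_top_iff_one _).2 (snd_mem_contentIdeal _)).trans Ideal.one_eq_top.symm)
  rw [vectorClass, this, map_one]

end ClassGroup

/-- The subgroup of the class group generated by the primes whose norm divides `n`. -/
noncomputable def primeClassSubgroup (R : Type*) [CommRing R] [IsDedekindDomain R]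
    [Module.Free ℤ R] (n : ℕ) : Subgroup (ClassGroup R) :=
  Subgroup.closure {c : ClassGroup R | ∃ P : (Ideal R)⁰,
    (P : Ideal R).IsPrime ∧ Ideal.absNorm (P : Ideal R) ∣ n ∧ ClassGroup.mk0 P = c}

/-- The classes of isotropic vectors agree modulo the primes whose norm divides the determinant. -/
theorem QuadraticConjugation.vectorClass_inv_mul_mem {R : Type*} [CommRing R] [IsDedekindDomain R]
    [Module.Free ℤ R] [Module.Finite ℤ R] [CharZero R] (Q : QuadraticConjugation R)
    (hrank : Module.finrank ℤ R = 2) {a : R}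
    {m m' : ℤ} {n : ℕ} (hn : n ≠ 0) (hdet : a * Q.bar a + Q.sqrtDiscr ^ 2 * m * m' = n)
    {u v : R × R} (hu : u ≠ 0) (hv : v ≠ 0) (huu : Q.skewForm a m m' u u = 0)
    (hvv : Q.skewForm a m m' v v = 0) :
    (vectorClass u hu)⁻¹ * vectorClass v hv ∈ primeClassSubgroup R n := by
  obtain ⟨x, y, G, hx, hy, hG, hGP, hrel⟩ :=
    Q.exists_contentIdeal_relation hrank hn hdet hu hv huu hvv
  have hG' : G ∈ (Ideal R)⁰ := mem_nonZeroDivisors_iff_ne_zero.2 hG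
  have h : vectorClass v hv = vectorClass u hu * ClassGroup.mk0 ⟨G, hG'⟩ := by
    rw [vectorClass, vectorClass, ← map_mul, ClassGroup.mk0_eq_mk0_iff]
    exact ⟨x, y, hx, hy, hrel⟩
  rw [h, inv_mul_cancel_left]
  exact ClassGroup.mk0_mem_of_forall_prime G hG' fun P hP hprime hle =>
    Subgroup.subset_closure ⟨⟨P, hP⟩, hprime, hGP P hprime hle, rfl⟩

/-! ### Points of the extended field as isotropic vectors. -/

section Points

variable {K : Type*} [Field K] [NumberField K] {Q : QuadraticConjugation (𝓞 K)} {σ : K →+* ℂ}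
  {D : ℝ} {C : OrientedCircle} {a : 𝓞 K} {m m' : ℤ}

open Classical in
/-- The point of the extended plane with given homogeneous coordinates. -/
noncomputable def projectivePoint (σ : K →+* ℂ) (u : 𝓞 K × 𝓞 K) : OnePoint ℂ :=
  if u.2 = 0 then OnePoint.infty else ((σ u.1 / σ u.2 : ℂ) : OnePoint ℂ)

theorem exists_projectivePoint_eq {p : OnePoint ℂ} (hp : p ∈ extendedField σ) :
    ∃ u : 𝓞 K × 𝓞 K, u ≠ 0 ∧ projectivePoint σ u = p := by
  rcases hp with rfl | ⟨x, rfl⟩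
  · exact ⟨(1, 0), by simp, by simp [projectivePoint]⟩
  · obtain ⟨y, z, hz, rfl⟩ := IsFractionRing.div_surjective (A := 𝓞 K) x
    have hz' : z ≠ 0 := nonZeroDivisors.ne_zero hz
    exact ⟨(y, z), by simp [hz'], by simp [projectivePoint, hz']⟩

theorem OrientedCircle.IsOfForm.projectivePoint_mem_iff (h : C.IsOfForm Q σ D a m m') (hD : 0 < D)
    (hbar : ∀ z : 𝓞 K, σ (Q.bar z : 𝓞 K) = conj (σ (z : K))) {u : 𝓞 K × 𝓞 K} (hu : u ≠ 0) :
    projectivePoint σ u ∈ C.points ↔ Q.skewForm a m m' u u = 0 := by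
  have h0 := I_mul_sqrt_ne_zero hD
  by_cases hu2 : u.2 = 0
  · have hu1 : u.1 ≠ 0 := fun h1 => hu (Prod.ext h1 hu2)
    have hm : C.curvature = 0 ↔ m = 0 := by
      have := h.curvature_eq
      constructor
      · intro hr
        rw [hr, Complex.ofReal_zero, mul_zero] at this
        simpa [Q.sqrtDiscr_ne_zero] using this.symm
      · rintro rfl
        rw [Int.cast_zero, mul_zero, mul_eq_zero] at this
        exact_mod_cast this.resolve_left h0
    simp [projectivePoint, hu2, infty_mem_points, hm, skewForm, hu1, Q.sqrtDiscr_ne_zero]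
  · rw [projectivePoint, if_neg hu2, coe_mem_points]
    have heq := h.equation_eq hbar u hu2
    have hnz : Complex.I * (√D : ℝ) * (σ u.2 * conj (σ u.2)) ≠ 0 :=
      mul_ne_zero h0 (by simpa using hu2)
    constructor
    · intro hz
      rw [hz, Complex.ofReal_zero, mul_zero] at heq
      simpa using heq.symm
    · intro hz
      simp only [hz, map_zero] at heq
      rw [mul_eq_zero] at heq
      exact_mod_cast heq.resolve_left hnz

end Points

/-! ### The integrality of D and the generation of the class group. -/

theorem corollary5p14 {K : Type*} [Field K] [NumberField K]
    (hdeg : Module.finrank ℚ K = 2) (himag : NumberField.IsTotallyComplex K)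
    (σ : K →+* ℂ) (D : ℝ) (hD : 0 < D)
    (hne : (circleArrangement σ D).Nonempty)
    (hfin : FinitelyConnected (circleArrangement σ D))
    (hrat : RationallyConnected σ (circleArrangement σ D)) :
    ∃ n : ℕ, (n : ℝ) = D ∧
      Subgroup.closure {c : ClassGroup (𝓞 K) | ∃ P : (Ideal (𝓞 K))⁰,
        (P : Ideal (𝓞 K)).IsPrime ∧ Ideal.absNorm (P : Ideal (𝓞 K)) ∣ n ∧
        ClassGroup.mk0 P = c} = ⊤ := by
  obtain ⟨Q, hbar, s, hs, hδ⟩ := exists_quadraticConjugation hdeg himag σ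
  have hA (C : OrientedCircle) := mem_circleArrangement_iff (C := C) (D := D) hbar hs hδ
  have hδ' : σ (Q.sqrtDiscr : 𝓞 K) =
      Complex.I * ((s * √(|(NumberField.discr K : ℝ)|) : ℝ) : ℂ) := by
    rw [hδ]; push_cast; ring
  have hrank : Module.finrank ℤ (𝓞 K) = 2 := (NumberField.RingOfIntegers.rank K).trans hdeg
  obtain ⟨n, hn⟩ : ∃ n : ℕ, (n : ℝ) = D := by
    obtain ⟨C, hC⟩ := hne
    obtain ⟨a, m, m', h⟩ := (hA C).1 hC
    obtain ⟨N, hN⟩ := Q.exists_int_of_bar_eq (a * Q.bar a + Q.sqrtDiscr ^ 2 * m * m') (by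
      simp only [map_add, map_mul, map_pow, map_intCast, Q.bar_bar, Q.bar_sqrtDiscr]
      ring)
    have hND : (N : ℝ) = D := by
      have := h.det_eq hD hbar
      rw [hN] at this
      simp only [map_intCast] at this
      exact_mod_cast this
    refine ⟨N.toNat, ?_⟩
    rw [← hND]
    have : 0 ≤ N := by
      rw [← hND] at hD
      exact_mod_cast hD.le
    exact_mod_cast Int.toNat_of_nonneg this
  refine ⟨n, hn, ?_⟩
  have hn0 : n ≠ 0 := by
    rintro rfl
    simp at hn
    exact hD.ne hn
  have hdet {C : OrientedCircle} {a : 𝓞 K} {m m' : ℤ} (h : C.IsOfForm Q σ D a m m') :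
      a * Q.bar a + Q.sqrtDiscr ^ 2 * m * m' = n := by
    have := h.det_eq hD hbar
    rw [← hn] at this
    refine NumberField.RingOfIntegers.ext (σ.injective ?_)
    rw [this]
    simp
  have hsame {C : OrientedCircle} (hC : C ∈ circleArrangement σ D) {u v : 𝓞 K × 𝓞 K}
      (hu : u ≠ 0) (hv : v ≠ 0) (huC : projectivePoint σ u ∈ C.points)
      (hvC : projectivePoint σ v ∈ C.points) :
      (vectorClass u hu)⁻¹ * vectorClass v hv ∈ primeClassSubgroup (𝓞 K) n := by
    obtain ⟨a, m, m', h⟩ := (hA C).1 hC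
    exact Q.vectorClass_inv_mul_mem hrank hn0 (hdet h) hu hv
      ((h.projectivePoint_mem_iff hD hbar hu).1 huC) ((h.projectivePoint_mem_iff hD hbar hv).1 hvC)
  have hcover {u : 𝓞 K × 𝓞 K} (hu : u.2 ≠ 0) :
      ∃ C ∈ circleArrangement σ D, projectivePoint σ u ∈ C.points := by
    obtain ⟨C, a, m, m', h, h0⟩ := hfin.exists_isotropic hbar hA hD hδ' hne hu
    exact ⟨C, (hA C).2 ⟨_, _, _, h⟩,
      (h.projectivePoint_mem_iff hD hbar (fun h' => hu (by simp [h']))).2 h0⟩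
  refine (Subgroup.eq_top_iff' (primeClassSubgroup (𝓞 K) n)).2 fun x => ?_
  obtain ⟨v, hv, rfl⟩ := exists_vectorClass_eq x
  -- The point 0, with vector (0, 1), serves as base point because its class is trivial.
  obtain ⟨C, hC, hCu⟩ := hcover (u := (0, 1)) one_ne_zero
  obtain ⟨C', hC', hCv⟩ := hcover hv
  obtain ⟨l, c, hc0, hcl, hcA, hmeet⟩ := hrat C hC C' hC'
  have hu0 : ((0, 1) : 𝓞 K × 𝓞 K) ≠ 0 := by simp
  -- Quantifying over all vectors on the k-th circle lets the induction pass to the next circle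
  -- through their common point in K ∪ {∞}.
  have hchain (k : ℕ) (hk : k ≤ l) : ∀ (w : 𝓞 K × 𝓞 K) (hw : w ≠ 0),
      projectivePoint σ w ∈ (c k).points →
        (vectorClass (0, 1) hu0)⁻¹ * vectorClass w hw ∈ primeClassSubgroup (𝓞 K) n := by
    induction k with
    | zero =>
      intro w hw hwc
      exact hsame (hcA 0 hk) hu0 hw (hc0 ▸ hCu) hwc
    | succ k ih =>
      intro w hw hwc
      obtain ⟨p, ⟨hp, hp'⟩, hpK⟩ := hmeet k (by omega)
      obtain ⟨q, hq, rfl⟩ := exists_projectivePoint_eq hpK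
      have h1 := ih (by omega) q hq hp
      have h2 := hsame (hcA (k + 1) hk) hq hw hp' hwc
      simpa [mul_assoc] using mul_mem h1 h2
  have := hchain l le_rfl v (fun h' => hv (by simp [h'])) (hcl ▸ hCv)
  rwa [vectorClass_zero_one, inv_one, one_mul] at this
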